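/- **Setting.** Let $(\Gamma,d)$ be a non-empty countable metric space that is $\nu$-regular with constant $\kappa$, where $\kappa,\nu>0$: every closed ball of radius $n+1$ ($n=0,1,2,\dots$) has at most $\kappa(n+1)^\nu$ points. To each $x\in\Gamma$ attach a finite-dimensional complex Hilbert space $\mathcal H_x$; for finite $\Lambda\subset\Gamma$ put $\mathcal A_\Lambda=\mathcal B(\bigotimes_{x\in\Lambda}\mathcal H_x)$ with the operator norm, and identify $A\in\mathcal A_{Z}$ with $A\otimes\mathbb 1_{\Lambda\setminus Z}\in\mathcal A_\Lambda$ for $Z\subset\Lambda$. A dissipative interaction $\mathscr L=\{L_Z\}$ assigns to every finite $Z\subset\Gamma$ a linear map $L_Z:\mathcal A_Z\to\mathcal A_Z$ in Lindblad form, $L_Z(A)=i[H_Z,A]+\sum_{j=1}^{\ell_Z}\big(K_j^*AK_j-\tfrac12\{K_j^*K_j,A\}\big)$ with $H_Z=H_Z^*$ and $H_Z,K_j\in\mathcal A_Z$. For finite $\Lambda$ let $\mathscr L^\Lambda=\sum_{Z\subset\Lambda}L_Z$ on $\mathcal A_\Lambda$ (each $L_Z$ extended as $L_Z\otimes\mathrm{id}$)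 and $T^\Lambda_t=e^{t\mathscr L^\Lambda}$, $t\ge0$. A non-increasing $F:[0,\infty)\to(0,\infty)$ is an $F$-function if $\|F\|=\sup_x\sum_yF(d(x,y))<\infty$ and $C_F<\infty$, where $C_F$ is the infimum of the constants $C$ with $\sum_zF(d(x,z))F(d(z,y))\le C\,F(d(x,y))$ for all $x,y\in\Gamma$. The $F$-norm $\|\mathscr L\|_F$ is the infimum of the $M$ with $\sum_{Z\ni x,y}\|L_Z\|_{cb}\le M\,F(d(x,y))$ for all $x,y\in\Gamma$, where $\|\Phi\|_{cb}=\sup_n\|\Phi\otimes\mathrm{id}_{M_n}\|$. **Theorem.** Let $\alpha>2\nu+1$ and $F(r)=(1+r)^{-\alpha}$. Let $\|\mathscr L\|_F<\infty$, and set $v=\|\mathscr L\|_FC_F$. Fix $\epsilon\in(0,\alpha-2\nu-1)$, put $\alpha_\epsilon=\alpha-\nu-1-\epsilon$ and $C_\epsilon=\sum_{n\ge0}(1+n)^{-(1+\epsilon)}$, and let $0<\delta<1$ satisfy $(1-\delta)\alpha_\epsilon>\nu$. Then $F$ is an $F$-function on $\Gamma$, the constant $$C=\frac{\kappa C_\epsilon}{C_F}\Big(\kappa\,2^{2\alpha_\epsilon}2^{1-\delta}(C_\epsilon+C_F)+e\,(C_F+\|F\|)\Big)$$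 is positive, and for all finite $X\subset\Lambda\subset\Gamma$, all $A\in\mathcal A_X$, all $r\ge1$ and all $t\ge0$ with $e\,v\,t\le r^\delta$, $$\big\|T^\Lambda_t(A)-T^{X(r)}_t(A)\big\|\le C\,\|A\|\,|X|\,\|\mathscr L\|_F\,\frac{t}{(1+r)^{(1-\delta)\alpha_\epsilon-\nu}} .$$ Here $X(r)$ is the $r$-neighbourhood of $X$ within the volume $\Lambda$, $X(r)=\{y\in\Lambda: d(y,x)\le r\text{ for some }x\in X\}$; when the full $r$-neighbourhood of $X$ in $\Gamma$ is contained in $\Lambda$, this is that full neighbourhood. -/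

import Mathlib

open scoped ENNReal Matrix.Norms.L2Operator

noncomputable section

namespace OpenSpin

/-! ### Geometry and decay functions -/

section Geometry

variable {Γ : Type*} [MetricSpace Γ]

/-- `Γ` is `ν`-regular with constant `κ`: closed balls of radius `n + 1` have at most
`κ (n + 1) ^ ν` points, for every natural number `n`. -/
def IsRegular (Γ : Type*) [MetricSpace Γ] (κ ν : ℝ) : Prop :=
  ∀ (x : Γ) (n : ℕ), (Metric.closedBall x ((n : ℝ) + 1)).Finite ∧
    ((Metric.closedBall x ((n : ℝ) + 1)).ncard : ℝ) ≤ κ * ((n : ℝ) + 1) ^ ν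

/-- The `r`-inflation `X(r)` of a finite set `X`. -/
def inflation (X : Finset Γ) (r : ℝ) : Set Γ := {y | ∃ x ∈ X, dist y x ≤ r}

/-- The part `X(r) ∩ Λ` of the `r`-inflation of `X` lying in the finite volume `Λ`. -/
def inflationIn (Λ X : Finset Γ) (r : ℝ) : Finset Γ :=
  haveI : DecidablePred (fun y => y ∈ inflation X r) := Classical.decPred _
  Λ.filter (fun y => y ∈ inflation X r)

theorem mem_inflationIn {Λ X : Finset Γ} {r : ℝ} {y : Γ} :
    y ∈ inflationIn Λ X r ↔ y ∈ Λ ∧ y ∈ inflation X r := by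
  simp [inflationIn]

theorem inflationIn_subset (Λ X : Finset Γ) (r : ℝ) : inflationIn Λ X r ⊆ Λ :=
  fun _ hy => (mem_inflationIn.1 hy).1

theorem subset_inflationIn {Λ X : Finset Γ} (hX : X ⊆ Λ) {r : ℝ} (hr : 0 ≤ r) :
    X ⊆ inflationIn Λ X r := fun x hx =>
  mem_inflationIn.2 ⟨hX hx, x, hx, by simpa using hr⟩

/-- `‖F‖ = sup_x ∑_y F(d(x,y))`, as an extended non-negative number. -/
def fSum (Γ : Type*) [MetricSpace Γ] (F : ℝ → ℝ) : ℝ≥0∞ :=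
  ⨆ x : Γ, ∑' y : Γ, ENNReal.ofReal (F (dist x y))

/-- The convolution constant `C_F`: the infimum of all `C` with
`∑_z F(d(x,z)) F(d(z,y)) ≤ C F(d(x,y))` for all `x, y`. -/
def convConst (Γ : Type*) [MetricSpace Γ] (F : ℝ → ℝ) : ℝ≥0∞ :=
  sInf {C : ℝ≥0∞ | ∀ x y : Γ,
    ∑' z : Γ, ENNReal.ofReal (F (dist x z)) * ENNReal.ofReal (F (dist z y))
      ≤ C * ENNReal.ofReal (F (dist x y))}

/-- `F` is an `F`-function on `Γ`: it is positive and non-increasing on `[0, ∞)`, uniformly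
summable, and satisfies the convolution condition with some finite constant. -/
structure IsFFunction (Γ : Type*) [MetricSpace Γ] (F : ℝ → ℝ) : Prop where
  pos : ∀ r : ℝ, 0 ≤ r → 0 < F r
  antitone : AntitoneOn F (Set.Ici 0)
  summable : fSum Γ F ≠ ∞
  convolution : convConst Γ F ≠ ∞

/-- The power law `F(r) = (1 + r) ^ (-α)`. -/
def powerLaw (α : ℝ) (r : ℝ) : ℝ := 1 / (1 + r) ^ α

end Geometry

/-! ### Local algebras

The Hilbert space at the site `x` has an orthonormal basis indexed by the finite type `ι x`.
Hence `ℋ_Λ = ⨂_{x ∈ Λ} ℋ_x` has the product orthonormal basis indexed by `Conf ι Λ`, and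
`𝒜_Λ = B(ℋ_Λ)` is the algebra of complex matrices over `Conf ι Λ` with the operator norm
coming from the Euclidean (`ℓ²`) norm. -/

section Algebra

variable {Γ : Type*} [DecidableEq Γ] (ι : Γ → Type*)
  [∀ x, Fintype (ι x)] [∀ x, DecidableEq (ι x)]

/-- Basis labels of `ℋ_Λ`. -/
abbrev Conf (Λ : Finset Γ) := (x : {x : Γ // x ∈ Λ}) → ι x

/-- The algebra `𝒜_Λ` of observables in the finite volume `Λ`. -/
abbrev Obs (Λ : Finset Γ) := Matrix (Conf ι Λ) (Conf ι Λ) ℂ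

variable {ι}

/-- Restriction of a label of `Λ` to `Z ⊆ Λ`. -/
def Conf.restrict {Z Λ : Finset Γ} (h : Z ⊆ Λ) (σ : Conf ι Λ) : Conf ι Z :=
  fun x => σ ⟨x, h x.2⟩

/-- The label of `Λ` that agrees with `a` on `Z` and with `σ` off `Z`. -/
def Conf.glue {Z Λ : Finset Γ} (a : Conf ι Z) (σ : Conf ι Λ) : Conf ι Λ :=
  fun x => if hx : (x : Γ) ∈ Z then a ⟨x, hx⟩ else σ x

/-- The identification `𝒜_Z ∋ A ↦ A ⊗ 𝟙_{Λ ∖ Z} ∈ 𝒜_Λ`. -/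
def embed {Z Λ : Finset Γ} (h : Z ⊆ Λ) (A : Obs ι Z) : Obs ι Λ :=
  Matrix.of fun σ τ =>
    if ∀ x : {x : Γ // x ∈ Λ}, (x : Γ) ∉ Z → σ x = τ x then A (σ.restrict h) (τ.restrict h) else 0

/-- The extension `Φ ⊗ id_{Λ ∖ Z}` to `𝒜_Λ` of a linear map `Φ` on `𝒜_Z`: the map `Φ` is applied
to each block of the matrix `M`, the blocks being labelled by the pairs of labels off `Z`. -/
def extend {Z Λ : Finset Γ} (h : Z ⊆ Λ) (Φ : Obs ι Z →ₗ[ℂ] Obs ι Z) : Obs ι Λ →ₗ[ℂ] Obs ι Λ where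
  toFun M := Matrix.of fun σ τ =>
    Φ (Matrix.of fun a b => M (a.glue σ) (b.glue τ)) (σ.restrict h) (τ.restrict h)
  map_add' M N := by
    ext σ τ
    exact congrFun (congrFun (Φ.map_add
      (Matrix.of fun a b : Conf ι Z => M (a.glue σ) (b.glue τ))
      (Matrix.of fun a b : Conf ι Z => N (a.glue σ) (b.glue τ))) _) _
  map_smul' c M := by
    ext σ τ
    exact congrFun (congrFun (Φ.map_smul c
      (Matrix.of fun a b : Conf ι Z => M (a.glue σ) (b.glue τ))) _) _

end Algebra

/-! ### The completely bounded norm -/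

section CB

variable {m : Type*} [Fintype m] [DecidableEq m]

/-- The block-wise action `Φ ⊗ 𝟙_{n × n}` on `n × n` block matrices; the `(k, l)` block of the
matrix `M` has the entries `M (i, k) (j, l)`. -/
def amplify (Φ : Matrix m m ℂ →ₗ[ℂ] Matrix m m ℂ) (n : ℕ) :
    Matrix (m × Fin n) (m × Fin n) ℂ →ₗ[ℂ] Matrix (m × Fin n) (m × Fin n) ℂ where
  toFun M := Matrix.of fun p q => Φ (Matrix.of fun i j => M (i, p.2) (j, q.2)) p.1 q.1
  map_add' M N := by
    ext p q
    exact congrFun (congrFun (Φ.map_add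
      (Matrix.of fun i j : m => M (i, p.2) (j, q.2))
      (Matrix.of fun i j : m => N (i, p.2) (j, q.2))) _) _
  map_smul' c M := by
    ext p q
    exact congrFun (congrFun (Φ.map_smul c
      (Matrix.of fun i j : m => M (i, p.2) (j, q.2))) _) _

/-- `‖Φ‖_cb = sup_n ‖Φ ⊗ 𝟙_{n × n}‖`, as an extended non-negative number. -/
def cbNorm (Φ : Matrix m m ℂ →ₗ[ℂ] Matrix m m ℂ) : ℝ≥0∞ :=
  ⨆ n : ℕ, ‖LinearMap.toContinuousLinearMap (amplify Φ n)‖ₑ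

/-- `Φ` is in Lindblad form:
`Φ(A) = i[H, A] + ∑_j (K_j* A K_j - ½ {K_j* K_j, A})` with `H = H*` and finitely many `K_j`. -/
def IsLindblad (Φ : Matrix m m ℂ →ₗ[ℂ] Matrix m m ℂ) : Prop :=
  ∃ (H : Matrix m m ℂ) (ℓ : ℕ) (K : Fin ℓ → Matrix m m ℂ), star H = H ∧
    ∀ A : Matrix m m ℂ, Φ A = Complex.I • (H * A - A * H) +
      ∑ j, (star (K j) * A * K j -
        (1 / 2 : ℂ) • (star (K j) * K j * A + A * (star (K j) * K j)))

end CB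

/-! ### Dissipative interactions and their finite-volume dynamics -/

section Dynamics

variable {Γ : Type*} [DecidableEq Γ] (ι : Γ → Type*)
  [∀ x, Fintype (ι x)] [∀ x, DecidableEq (ι x)]

/-- A dissipative interaction: a family of maps `L_Z : 𝒜_Z → 𝒜_Z` in Lindblad form, indexed by the
finite subsets `Z` of `Γ`. -/
structure Interaction where
  term : (Z : Finset Γ) → (Obs ι Z →ₗ[ℂ] Obs ι Z)
  lindblad : ∀ Z, IsLindblad (term Z)

variable {ι}

/-- The `F`-norm `‖𝓛‖_F`: the infimum of all `M` such that
`∑_{Z ∋ x, y} ‖L_Z‖_cb ≤ M F(d(x,y))` for all `x, y`. -/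
def Interaction.fNorm [MetricSpace Γ] (L : Interaction ι) (F : ℝ → ℝ) : ℝ≥0∞ :=
  sInf {M : ℝ≥0∞ | ∀ x y : Γ,
    ∑' Z : {Z : Finset Γ // x ∈ Z ∧ y ∈ Z}, cbNorm (L.term Z.1)
      ≤ M * ENNReal.ofReal (F (dist x y))}

/-- The finite-volume generator `𝓛^Λ = ∑_{Z ⊆ Λ} L_Z` on `𝒜_Λ`. -/
def Interaction.generator (L : Interaction ι) (Λ : Finset Γ) : Obs ι Λ →L[ℂ] Obs ι Λ :=
  LinearMap.toContinuousLinearMap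
    (∑ Z ∈ Λ.powerset.attach, extend (Finset.mem_powerset.1 Z.2) (L.term Z.1))

/-- The finite-volume dynamics `T_t^Λ = exp(t 𝓛^Λ)` on `𝒜_Λ`. -/
def Interaction.dynamics (L : Interaction ι) (Λ : Finset Γ) (t : ℝ) : Obs ι Λ →L[ℂ] Obs ι Λ :=
  NormedSpace.exp ((t : ℂ) • L.generator Λ)

end Dynamics

/-! ### The constants of the estimate -/

/-- `C_ε = ∑_{n ≥ 0} (1 + n) ^ (-(1 + ε))`. -/
def zetaConst (ε : ℝ) : ℝ := ∑' n : ℕ, 1 / (1 + (n : ℝ)) ^ (1 + ε)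

/-- The constant
`κ C_ε / C_F * (κ 2^(2 α_ε) 2^(1-δ) (C_ε + C_F) + e (C_F + ‖F‖))`
for `F(r) = (1 + r) ^ (-α)` and `α_ε = α - ν - 1 - ε`. -/
def localizationConst (Γ : Type*) [MetricSpace Γ] (κ ν α ε δ : ℝ) : ℝ :=
  κ * zetaConst ε / (convConst Γ (powerLaw α)).toReal *
    (κ * 2 ^ (2 * (α - ν - 1 - ε)) * 2 ^ (1 - δ) *
        (zetaConst ε + (convConst Γ (powerLaw α)).toReal) +
      Real.exp 1 * ((convConst Γ (powerLaw α)).toReal + (fSum Γ (powerLaw α)).toReal))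

end OpenSpin

end

set_option linter.unusedSectionVars false

namespace OpenSpin

/-! ### The algebra of local observables -/

section Embedding

variable {Γ : Type*} [DecidableEq Γ] {ι : Γ → Type*}

/-! Cut the interaction at range ρ = r^(1-δ), and compare both dynamics with the one generated by
the short sets (diameter at most ρ) inside Y = X(r). By Duhamel, each difference is controlled by
the time integral of what the discarded terms do to the evolved observable. The outer semigroup
drops out because it is contractive: Lindblad generators are dissipative, since A*Aψ = ‖A‖²ψ
wherever A attains its norm, and this forces Re⟨Aψ, L(A)ψ⟩ ≤ 0.

Discarded sets disjoint from Y contribute nothing. For the long sets touching Y (`sum_long_le`),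
each point of Y costs ‖𝓛‖_F times the tail of F beyond ρ/2. As |Y| ≤ κ|X|(1+r)^ν, this gives the
decay (1+r)^(ν-(1-δ)α_ε).

Short sets crossing the boundary of Y are handled by a Lieb–Robinson bound,
`IsLocalFamily.lieb_robinson`: the norm of L_Z on the evolved observable is at most ‖L_Z‖_cb ‖A‖
∑_{z∈Z} (exp(sM) 1_X)(z), where M(z,y) sums ‖L_Z‖_cb over the short Z containing z and y. Each
factor M spreads supports by at most ρ, so only orders k > r/ρ = r^δ reach beyond Y. The condition e
v t ≤ r^δ makes this exponential tail linear in t (`sum_pow_div_factorial_le`), and the tail of F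
beyond r supplies (1+r)^(-α_ε). `Interaction.norm_dynamics_sub_le` assembles the two contributions.
-/

@[simp]
theorem Conf.glue_restrict {Z Λ : Finset Γ} (h : Z ⊆ Λ) (σ : Conf ι Λ) :
    (σ.restrict h).glue σ = σ := by
  ext x
  by_cases hx : (x : Γ) ∈ Z <;> simp [Conf.glue, Conf.restrict, hx]

@[simp]
theorem Conf.restrict_glue {Z Λ : Finset Γ} (h : Z ⊆ Λ) (a : Conf ι Z) (σ : Conf ι Λ) :
    (a.glue σ).restrict h = a := by
  ext x
  simp [Conf.glue, Conf.restrict]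

theorem Conf.glue_of_notMem {Z Λ : Finset Γ} (a : Conf ι Z) (σ : Conf ι Λ)
    {x : {x : Γ // x ∈ Λ}} (hx : (x : Γ) ∉ Z) : a.glue σ x = σ x := by
  simp [Conf.glue, hx]

theorem Conf.glue_injective {Z Λ : Finset Γ} (h : Z ⊆ Λ) (σ : Conf ι Λ) :
    Function.Injective fun a : Conf ι Z => a.glue σ := fun a b hab => by
  have := congrArg (Conf.restrict h) hab
  simpa using this

theorem Conf.eq_glue_restrict {Z Λ : Finset Γ} (h : Z ⊆ Λ) {σ τ : Conf ι Λ}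
    (hστ : ∀ x : {x : Γ // x ∈ Λ}, (x : Γ) ∉ Z → σ x = τ x) : (τ.restrict h).glue σ = τ := by
  ext x
  by_cases hx : (x : Γ) ∈ Z
  · simp [Conf.glue, Conf.restrict, hx]
  · simp [Conf.glue, hx, hστ x hx]

variable [∀ x, Fintype (ι x)] [∀ x, DecidableEq (ι x)]

/-- Row σ of B ⊗ 𝟙 is supported on the labels agreeing with σ off Z, and these are exactly the
`a.glue σ`. -/
theorem embed_mul_apply {Z Λ : Finset Γ} (h : Z ⊆ Λ) (B : Obs ι Z) (M : Obs ι Λ)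
    (σ τ : Conf ι Λ) :
    (embed h B * M) σ τ = ∑ a : Conf ι Z, B (σ.restrict h) a * M (a.glue σ) τ := by
  rw [Matrix.mul_apply]
  symm
  refine Fintype.sum_of_injective _ (Conf.glue_injective h σ) _ _ ?_ ?_
  · intro σ' hσ'
    rw [embed, Matrix.of_apply, if_neg, zero_mul]
    exact fun hc => hσ' ⟨σ'.restrict h, Conf.eq_glue_restrict h hc⟩
  · intro a
    rw [embed, Matrix.of_apply, if_pos, Conf.restrict_glue]
    exact fun x hx => (Conf.glue_of_notMem a σ hx).symm

theorem mul_embed_apply {Z Λ : Finset Γ} (h : Z ⊆ Λ) (M : Obs ι Λ) (B : Obs ι Z)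
    (σ τ : Conf ι Λ) :
    (M * embed h B) σ τ = ∑ a : Conf ι Z, M σ (a.glue τ) * B a (τ.restrict h) := by
  rw [Matrix.mul_apply]
  symm
  refine Fintype.sum_of_injective _ (Conf.glue_injective h τ) _ _ ?_ ?_
  · intro σ' hσ'
    rw [embed, Matrix.of_apply, if_neg, mul_zero]
    exact fun hc => hσ' ⟨σ'.restrict h, Conf.eq_glue_restrict h fun x hx => (hc x hx).symm⟩
  · intro a
    rw [embed, Matrix.of_apply, if_pos, Conf.restrict_glue]
    exact fun x hx => Conf.glue_of_notMem a τ hx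

theorem embed_add {Z Λ : Finset Γ} (h : Z ⊆ Λ) (A B : Obs ι Z) :
    embed h (A + B) = embed h A + embed h B := by
  ext σ τ
  simp only [embed, Matrix.of_apply, Matrix.add_apply]
  split_ifs <;> simp

theorem embed_smul {Z Λ : Finset Γ} (h : Z ⊆ Λ) (c : ℂ) (A : Obs ι Z) :
    embed h (c • A) = c • embed h A := by
  ext σ τ
  simp [embed, Matrix.smul_apply]

theorem embed_star {Z Λ : Finset Γ} (h : Z ⊆ Λ) (A : Obs ι Z) :
    embed h (star A) = star (embed h A) := by
  ext σ τ
  simp only [embed, Matrix.star_apply, Matrix.of_apply]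
  by_cases hc : ∀ x : {x : Γ // x ∈ Λ}, (x : Γ) ∉ Z → σ x = τ x
  · rw [if_pos hc, if_pos fun x hx => (hc x hx).symm]
  · rw [if_neg hc, if_neg fun hc' => hc fun x hx => (hc' x hx).symm, star_zero]

theorem embed_mul {Z Λ : Finset Γ} (h : Z ⊆ Λ) (A B : Obs ι Z) :
    embed h (A * B) = embed h A * embed h B := by
  ext σ τ
  rw [embed_mul_apply]
  simp only [embed, Matrix.of_apply, Matrix.mul_apply, Conf.restrict_glue]
  have key : ∀ a : Conf ι Z, (∀ x : {x : Γ // x ∈ Λ}, (x : Γ) ∉ Z → a.glue σ x = τ x) ↔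
      ∀ x : {x : Γ // x ∈ Λ}, (x : Γ) ∉ Z → σ x = τ x := fun a =>
    forall₂_congr fun x hx => by rw [Conf.glue_of_notMem a σ hx]
  simp only [key]
  split_ifs <;> simp

theorem embed_one {Z Λ : Finset Γ} (h : Z ⊆ Λ) : embed h (1 : Obs ι Z) = 1 := by
  ext σ τ
  simp only [embed, Matrix.of_apply, Matrix.one_apply]
  by_cases hστ : σ = τ
  · simp [hστ]
  · rw [if_neg hστ]
    split_ifs with h1 h2
    · exact absurd (by rw [← Conf.eq_glue_restrict h h1, ← h2, Conf.glue_restrict]) hστ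
    · rfl
    · rfl

theorem embed_refl {Λ : Finset Γ} (A : Obs ι Λ) : embed subset_rfl A = A := by
  ext σ τ
  rw [embed, Matrix.of_apply, if_pos fun x hx => absurd x.2 hx]
  rfl

theorem embed_embed {Z Y Λ : Finset Γ} (h : Z ⊆ Y) (h' : Y ⊆ Λ) (A : Obs ι Z) :
    embed h' (embed h A) = embed (h.trans h') A := by
  ext σ τ
  simp only [embed, Matrix.of_apply, ← ite_and]
  refine if_congr ⟨fun hc x hx => ?_, fun hc => ⟨fun x hx => hc x fun hz => hx (h hz),
    fun x hx => hc ⟨x, h' x.2⟩ hx⟩⟩ rfl rfl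
  by_cases hy : (x : Γ) ∈ Y
  · exact hc.2 ⟨x, hy⟩ hx
  · exact hc.1 x hy

/-- The identification `𝒜_Z → 𝒜_Λ` as a homomorphism of star algebras. -/
def embedHom {Z Λ : Finset Γ} (h : Z ⊆ Λ) : Obs ι Z →⋆ₐ[ℂ] Obs ι Λ where
  toFun := embed h
  map_one' := embed_one h
  map_mul' := embed_mul h
  map_zero' := by simpa using embed_smul h 0 (0 : Obs ι Z)
  map_add' := embed_add h
  commutes' c := by
    rw [Algebra.algebraMap_eq_smul_one, Algebra.algebraMap_eq_smul_one, embed_smul, embed_one]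
  map_star' := embed_star h

@[simp]
theorem embedHom_apply {Z Λ : Finset Γ} (h : Z ⊆ Λ) (A : Obs ι Z) :
    embedHom h A = embed h A := rfl

theorem norm_embed_le {Z Λ : Finset Γ} (h : Z ⊆ Λ) (A : Obs ι Z) : ‖embed h A‖ ≤ ‖A‖ :=
  NonUnitalStarAlgHom.norm_apply_le (embedHom h) A

/-- In each product a single intermediate label survives, and both orders give A(σ|Z, τ|Z) B(σ|Y,
τ|Y) when σ and τ agree off Z ∪ Y, and 0 otherwise. -/
theorem commute_embed {Z Y Λ : Finset Γ} (hZ : Z ⊆ Λ) (hY : Y ⊆ Λ) (hd : Disjoint Z Y)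
    (A : Obs ι Z) (B : Obs ι Y) : Commute (embed hZ A) (embed hY B) := by
  have hZY : ∀ {x}, x ∈ Z → x ∉ Y := fun hx hy => Finset.disjoint_left.1 hd hx hy
  have hr : ∀ (σ : Conf ι Λ) (a : Conf ι Z), (a.glue σ).restrict hY = σ.restrict hY := by
    intro σ a
    ext x
    exact Conf.glue_of_notMem a σ fun hz => hZY hz x.2
  ext σ τ
  rw [embed_mul_apply, mul_embed_apply]
  simp only [embed, Matrix.of_apply, hr]
  rw [Finset.sum_eq_single (τ.restrict hZ), Finset.sum_eq_single (σ.restrict hZ), mul_comm]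
  · congr 1
    refine if_congr ⟨fun hc x hx => ?_, fun hc x hx => ?_⟩ rfl rfl
    · by_cases hz : (x : Γ) ∈ Z
      · simp [Conf.glue, Conf.restrict, hz]
      · simpa [Conf.glue, hz] using hc x hx
    · by_cases hz : (x : Γ) ∈ Z
      · simp [Conf.glue, Conf.restrict, hz]
      · simpa [Conf.glue, hz] using hc x hx
  · intro a _ ha
    rw [if_neg, zero_mul]
    refine fun hc => ha ?_
    ext x
    simpa [Conf.glue, Conf.restrict] using (hc ⟨x, hZ x.2⟩ (hZY x.2)).symm
  · simp
  · intro a _ ha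
    rw [if_neg, mul_zero]
    refine fun hc => ha ?_
    ext x
    simpa [Conf.glue, Conf.restrict] using hc ⟨x, hZ x.2⟩ (hZY x.2)
  · simp

end Embedding

/-! ### Generators in Lindblad form -/

section Lindblad

variable {m : Type*} [Fintype m] [DecidableEq m]

/-- The generator `A ↦ i[H, A] + ∑_j (K_j* A K_j - ½ {K_j* K_j, A})`. -/
noncomputable def lindbladMap (H : Matrix m m ℂ) {ℓ : ℕ} (K : Fin ℓ → Matrix m m ℂ) (A : Matrix m m ℂ) :
    Matrix m m ℂ :=
  Complex.I • (H * A - A * H) + ∑ j, (star (K j) * A * K j -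
    (1 / 2 : ℂ) • (star (K j) * K j * A + A * (star (K j) * K j)))

variable (H : Matrix m m ℂ) {ℓ : ℕ} (K : Fin ℓ → Matrix m m ℂ)

@[simp]
theorem lindbladMap_one : lindbladMap H K 1 = 0 := by
  simp [lindbladMap, ← two_smul ℂ, smul_smul]

variable {H K}

/-- A Lindblad map is a bimodule map over the commutant of H, the K_j and their adjoints. All
locality statements for generators rest on this. -/
theorem lindbladMap_mul_left {B : Matrix m m ℂ} (hH : Commute B H) (hK : ∀ j, Commute B (K j))
    (hK' : ∀ j, Commute B (star (K j))) (A : Matrix m m ℂ) :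
    lindbladMap H K (B * A) = B * lindbladMap H K A := by
  simp only [lindbladMap, mul_add, mul_sub, Finset.mul_sum, mul_smul_comm, ← mul_assoc]
  refine congrArg₂ (· + ·) ?_ (Finset.sum_congr rfl fun j _ => ?_)
  · rw [← hH.eq]
  · rw [mul_assoc (star (K j)) (K j) B, ← (hK j).eq, ← mul_assoc, ← (hK' j).eq]

theorem lindbladMap_mul_right {B : Matrix m m ℂ} (hH : Commute B H) (hK : ∀ j, Commute B (K j))
    (hK' : ∀ j, Commute B (star (K j))) (A : Matrix m m ℂ) :
    lindbladMap H K (A * B) = lindbladMap H K A * B := by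
  simp only [lindbladMap, add_mul, sub_mul, Finset.sum_mul, smul_mul_assoc, mul_assoc]
  refine congrArg₂ (· + ·) ?_ (Finset.sum_congr rfl fun j _ => ?_)
  · rw [hH.eq]
  · rw [(hK j).eq, ← mul_assoc B (star (K j)), (hK' j).eq, mul_assoc, (hK j).eq]

end Lindblad

/-! ### Locality of the extended generators -/

section Extension

variable {Γ : Type*} [DecidableEq Γ] {ι : Γ → Type*}
  [∀ x, Fintype (ι x)] [∀ x, DecidableEq (ι x)]

/-- The block of `M ∈ 𝒜_Λ` that belongs to the labels of `σ` and `τ` off `Z`. -/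
def block (Z : Finset Γ) {Λ : Finset Γ} (σ τ : Conf ι Λ) : Obs ι Λ →ₗ[ℂ] Obs ι Z where
  toFun M := Matrix.of fun a b => M (a.glue σ) (b.glue τ)
  map_add' _ _ := rfl
  map_smul' _ _ := rfl

theorem block_apply (Z : Finset Γ) {Λ : Finset Γ} (σ τ : Conf ι Λ) (M : Obs ι Λ)
    (a b : Conf ι Z) : block Z σ τ M a b = M (a.glue σ) (b.glue τ) := rfl

theorem extend_apply {Z Λ : Finset Γ} (h : Z ⊆ Λ) (Φ : Obs ι Z →ₗ[ℂ] Obs ι Z) (M : Obs ι Λ)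
    (σ τ : Conf ι Λ) : extend h Φ M σ τ = Φ (block Z σ τ M) (σ.restrict h) (τ.restrict h) := rfl

theorem Conf.glue_glue {Z Λ : Finset Γ} (a b : Conf ι Z) (σ : Conf ι Λ) :
    a.glue (b.glue σ) = a.glue σ := by
  ext x
  by_cases hx : (x : Γ) ∈ Z <;> simp [Conf.glue, hx]

theorem block_embed_mul {Z Λ : Finset Γ} (h : Z ⊆ Λ) (B : Obs ι Z) (M : Obs ι Λ)
    (σ τ : Conf ι Λ) : block Z σ τ (embed h B * M) = B * block Z σ τ M := by
  ext a b
  rw [block_apply, embed_mul_apply, Matrix.mul_apply]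
  simp [block_apply, Conf.glue_glue]

theorem block_mul_embed {Z Λ : Finset Γ} (h : Z ⊆ Λ) (M : Obs ι Λ) (B : Obs ι Z)
    (σ τ : Conf ι Λ) : block Z σ τ (M * embed h B) = block Z σ τ M * B := by
  ext a b
  rw [block_apply, mul_embed_apply, Matrix.mul_apply]
  simp [block_apply, Conf.glue_glue]

/-- Taking blocks intertwines multiplication by embedded elements with multiplication in 𝒜_Z, so the
block-wise definition reduces to algebra with H ⊗ 𝟙 and K_j ⊗ 𝟙. -/
theorem extend_eq_lindbladMap {Z Λ : Finset Γ} (h : Z ⊆ Λ) {Φ : Obs ι Z →ₗ[ℂ] Obs ι Z}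
    {H : Obs ι Z} {ℓ : ℕ} {K : Fin ℓ → Obs ι Z} (hΦ : ∀ A, Φ A = lindbladMap H K A)
    (M : Obs ι Λ) :
    extend h Φ M = lindbladMap (embed h H) (fun j => embed h (K j)) M := by
  have hb : ∀ σ τ : Conf ι Λ, block Z σ τ (lindbladMap (embed h H) (fun j => embed h (K j)) M) =
      lindbladMap H K (block Z σ τ M) := fun σ τ => by
    simp only [lindbladMap, map_add, map_smul, map_sub, map_sum, ← embed_star, mul_assoc,
      block_embed_mul]
    simp only [← mul_assoc, block_mul_embed]
  ext σ τ
  rw [extend_apply, hΦ, ← hb, block_apply, Conf.glue_restrict, Conf.glue_restrict]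

theorem embed_lindbladMap {Z Λ : Finset Γ} (h : Z ⊆ Λ) (H : Obs ι Z) {ℓ : ℕ}
    (K : Fin ℓ → Obs ι Z) (A : Obs ι Z) :
    embed h (lindbladMap H K A) =
      lindbladMap (embed h H) (fun j => embed h (K j)) (embed h A) := by
  simp only [← embedHom_apply, lindbladMap, map_add, map_smul, map_sub, map_sum, map_mul, map_star]

theorem IsLindblad.exists_eq {m : Type*} [Fintype m] [DecidableEq m]
    {Φ : Matrix m m ℂ →ₗ[ℂ] Matrix m m ℂ} (hΦ : IsLindblad Φ) :
    ∃ (H : Matrix m m ℂ) (ℓ : ℕ) (K : Fin ℓ → Matrix m m ℂ), star H = H ∧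
      ∀ A, Φ A = lindbladMap H K A := hΦ

theorem IsLindblad.extend {Z Λ : Finset Γ} (h : Z ⊆ Λ) {Φ : Obs ι Z →ₗ[ℂ] Obs ι Z}
    (hΦ : IsLindblad Φ) : IsLindblad (extend h Φ) := by
  obtain ⟨H, ℓ, K, hH, hK⟩ := hΦ.exists_eq
  exact ⟨embed h H, ℓ, fun j => embed h (K j), by rw [← embed_star, hH],
    extend_eq_lindbladMap h hK⟩

theorem embed_extend {Z Y Λ : Finset Γ} (h : Z ⊆ Y) (h' : Y ⊆ Λ) {Φ : Obs ι Z →ₗ[ℂ] Obs ι Z}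
    (hΦ : IsLindblad Φ) (A : Obs ι Y) :
    embed h' (extend h Φ A) = extend (h.trans h') Φ (embed h' A) := by
  obtain ⟨H, ℓ, K, -, hK⟩ := hΦ.exists_eq
  simp only [extend_eq_lindbladMap _ hK, embed_lindbladMap, embed_embed]

/-- An observable supported off Z factors out by the module property, leaving the generator applied
to 𝟙, which is 0. -/
theorem extend_embed_of_disjoint {Z X Λ : Finset Γ} (h : Z ⊆ Λ) (hX : X ⊆ Λ)
    (hd : Disjoint Z X) {Φ : Obs ι Z →ₗ[ℂ] Obs ι Z} (hΦ : IsLindblad Φ) (A : Obs ι X) :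
    extend h Φ (embed hX A) = 0 := by
  obtain ⟨H, ℓ, K, -, hK⟩ := hΦ.exists_eq
  rw [extend_eq_lindbladMap _ hK, ← mul_one (embed hX A), lindbladMap_mul_left, lindbladMap_one,
    mul_zero]
  · exact commute_embed _ _ hd.symm _ _
  · exact fun j => commute_embed _ _ hd.symm _ _
  · exact fun j => embed_star h (K j) ▸ commute_embed _ _ hd.symm _ _

/-- Ψ is a combination of left and right multiplications by elements of 𝒜_Y, and Φ commutes with all
of those. -/
theorem extend_comm_of_disjoint {Z Y Λ : Finset Γ} (h : Z ⊆ Λ) (hY : Y ⊆ Λ)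
    (hd : Disjoint Z Y) {Φ : Obs ι Z →ₗ[ℂ] Obs ι Z} {Ψ : Obs ι Y →ₗ[ℂ] Obs ι Y}
    (hΦ : IsLindblad Φ) (hΨ : IsLindblad Ψ) (M : Obs ι Λ) :
    extend h Φ (extend hY Ψ M) = extend hY Ψ (extend h Φ M) := by
  obtain ⟨H, ℓ, K, -, hK⟩ := hΦ.exists_eq
  obtain ⟨H', ℓ', K', -, hK'⟩ := hΨ.exists_eq
  have hl : ∀ (B : Obs ι Y) (M : Obs ι Λ),
      extend h Φ (embed hY B * M) = embed hY B * extend h Φ M := fun B M => by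
    rw [extend_eq_lindbladMap _ hK, extend_eq_lindbladMap _ hK, lindbladMap_mul_left]
    · exact commute_embed _ _ hd.symm _ _
    · exact fun j => commute_embed _ _ hd.symm _ _
    · exact fun j => embed_star h (K j) ▸ commute_embed _ _ hd.symm _ _
  have hr : ∀ (B : Obs ι Y) (M : Obs ι Λ),
      extend h Φ (M * embed hY B) = extend h Φ M * embed hY B := fun B M => by
    rw [extend_eq_lindbladMap _ hK, extend_eq_lindbladMap _ hK, lindbladMap_mul_right]
    · exact commute_embed _ _ hd.symm _ _
    · exact fun j => commute_embed _ _ hd.symm _ _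
    · exact fun j => embed_star h (K j) ▸ commute_embed _ _ hd.symm _ _
  rw [extend_eq_lindbladMap hY hK', extend_eq_lindbladMap hY hK']
  simp only [lindbladMap, map_add, map_smul, map_sub, map_sum, ← embed_star, mul_assoc, hl]
  simp only [← mul_assoc, hr]

end Extension

/-! ### Norms of extensions -/

section Norm

variable {Γ : Type*} [DecidableEq Γ] {ι : Γ → Type*}
  [∀ x, Fintype (ι x)] [∀ x, DecidableEq (ι x)]

/-- Reindexing as an isomorphism of star algebras of complex matrices. -/
def reindexStarAlgEquiv {m n : Type*} [Fintype m] [DecidableEq m] [Fintype n] [DecidableEq n]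
    (e : m ≃ n) : Matrix m m ℂ ≃⋆ₐ[ℂ] Matrix n n ℂ :=
  StarAlgEquiv.ofAlgEquiv (Matrix.reindexAlgEquiv ℂ ℂ e) fun A => by
    ext i j
    rfl

theorem norm_reindex {m n : Type*} [Fintype m] [DecidableEq m] [Fintype n] [DecidableEq n]
    (e : m ≃ n) (A : Matrix m m ℂ) : ‖Matrix.reindex e e A‖ = ‖A‖ := by
  refine le_antisymm (NonUnitalStarAlgHom.norm_apply_le (reindexStarAlgEquiv e) A) ?_
  conv_lhs => rw [← (reindexStarAlgEquiv e).symm_apply_apply A]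
  exact NonUnitalStarAlgHom.norm_apply_le (reindexStarAlgEquiv e).symm _

/-- A label of `Λ` is a label of `Z ⊆ Λ` together with a label of `Λ ∖ Z`. -/
def confEquiv {Z Λ : Finset Γ} (h : Z ⊆ Λ) :
    Conf ι Λ ≃ Conf ι Z × ((x : {x : {x : Γ // x ∈ Λ} // (x : Γ) ∉ Z}) → ι x) where
  toFun σ := (σ.restrict h, fun x => σ x)
  invFun p x := if hx : (x : Γ) ∈ Z then p.1 ⟨x, hx⟩ else p.2 ⟨x, hx⟩
  left_inv σ := by
    ext x
    by_cases hx : (x : Γ) ∈ Z <;> simp [Conf.restrict, hx]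
  right_inv p := by
    ext x
    · simp [Conf.restrict]
    · simp [x.2]

theorem norm_extend_le {Z Λ : Finset Γ} (h : Z ⊆ Λ) (Φ : Obs ι Z →ₗ[ℂ] Obs ι Z)
    (hΦ : cbNorm Φ ≠ ∞) (M : Obs ι Λ) : ‖extend h Φ M‖ ≤ (cbNorm Φ).toReal * ‖M‖ := by
  classical
  let e := (confEquiv (ι := ι) h).trans (Equiv.prodCongr (Equiv.refl _) (Fintype.equivFin _))
  -- With n the number of labels off Z, Φ ⊗ id on 𝒜_Λ is the n-th amplification of Φ up to
  -- relabelling, so the cb norm bounds it uniformly in Λ.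
  have he : Matrix.reindex e e (extend h Φ M) = amplify Φ _ (Matrix.reindex e e M) := by
    ext p q
    obtain ⟨σ, rfl⟩ := e.surjective p
    obtain ⟨τ, rfl⟩ := e.surjective q
    have hg : ∀ (a : Conf ι Z) (σ : Conf ι Λ), e.symm (a, (e σ).2) = a.glue σ := by
      intro a σ
      ext x
      by_cases hx : (x : Γ) ∈ Z <;> simp [e, confEquiv, Conf.glue, hx]
    have h1 : ∀ σ : Conf ι Λ, (e σ).1 = σ.restrict h := fun σ => rfl
    simp only [amplify, LinearMap.coe_mk, AddHom.coe_mk, Matrix.of_apply, Matrix.reindex_apply,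
      Matrix.submatrix_apply, hg, h1, extend_apply, Conf.glue_restrict]
    rfl
  rw [← norm_reindex e, he, ← norm_reindex e M]
  refine ((LinearMap.toContinuousLinearMap (amplify Φ _)).le_opNorm _).trans ?_
  gcongr
  rw [← toReal_enorm]
  exact ENNReal.toReal_mono hΦ (le_iSup (fun n => ‖LinearMap.toContinuousLinearMap
    (amplify Φ n)‖ₑ) _)

end Norm

end OpenSpin

namespace OpenSpin

/-! ### Dissipativity and contraction semigroups -/

section Contraction

open Filter Topology Set

variable {E : Type*} [NormedAddCommGroup E] [NormedSpace ℂ E] [CompleteSpace E]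

theorem hasDerivAt_exp_smul (P : E →L[ℂ] E) (s : ℝ) :
    HasDerivAt (fun s : ℝ => NormedSpace.exp ((s : ℂ) • P))
      (P * NormedSpace.exp ((s : ℂ) • P)) s := by
  have h := (hasDerivAt_exp_smul_const' (𝕂 := ℂ) P (s : ℂ)).scomp s
    Complex.ofRealCLM.hasDerivAt
  simpa [Function.comp_def] using h

theorem hasDerivAt_exp_smul_apply (P : E →L[ℂ] E) (a : E) (s : ℝ) :
    HasDerivAt (fun s : ℝ => NormedSpace.exp ((s : ℂ) • P) a)
      (P (NormedSpace.exp ((s : ℂ) • P) a)) s := by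
  have h := (ContinuousLinearMap.apply ℂ E a).hasFDerivAt.restrictScalars ℝ
    |>.comp_hasDerivAt s (hasDerivAt_exp_smul P s)
  exact h

/-- `P` is dissipative: `‖A‖ ≤ ‖A - c P A‖` for all `c ≥ 0`. -/
def IsDissipative (P : E →L[ℂ] E) : Prop :=
  ∀ (A : E) (c : ℝ), 0 ≤ c → ‖A‖ ≤ ‖A - (c : ℂ) • P A‖

theorem IsDissipative.norm_exp_apply_le {P : E →L[ℂ] E} (hP : IsDissipative P) {t : ℝ}
    (ht : 0 ≤ t) (A : E) : ‖NormedSpace.exp ((t : ℂ) • P) A‖ ≤ ‖A‖ := by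
  set f : ℝ → E := fun s => NormedSpace.exp ((s : ℂ) • P) A with hf
  have hd : ∀ s, HasDerivAt f (P (f s)) s := hasDerivAt_exp_smul_apply P A
  have hc : Continuous f := continuous_iff_continuousAt.2 fun s => (hd s).continuousAt
  have hf0 : f 0 = A := by simp [hf]
  have hslope : ∀ x ∈ Ico 0 t, ∀ r, (0 : ℝ) < r →
      ∃ᶠ z in 𝓝[>] x, slope (norm ∘ f) x z < r := by
    intro x _ r hr
    refine Eventually.frequently ?_
    have h1 : Tendsto (fun z => ‖slope f x z - P (f z)‖) (𝓝[>] x) (𝓝 0) := by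
      have h2 : Tendsto (slope f x) (𝓝[>] x) (𝓝 (P (f x))) :=
        (hasDerivAt_iff_tendsto_slope.1 (hd x)).mono_left
          (nhdsWithin_mono _ fun z hz => ne_of_gt hz)
      have h3 : Tendsto (fun z => P (f z)) (𝓝[>] x) (𝓝 (P (f x))) :=
        ((P.continuous.comp hc).tendsto x).mono_left nhdsWithin_le_nhds
      simpa using (h2.sub h3).norm
    filter_upwards [h1.eventually (gt_mem_nhds hr), self_mem_nhdsWithin] with z hz hxz
    have hxz' : 0 < z - x := sub_pos.2 hxz
    refine lt_of_le_of_lt ?_ hz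
    rw [slope_def_field, div_le_iff₀ hxz']
    -- Backward Euler: f x differs from f z - (z - x) P f z by o(z - x), and dissipativity at the
    -- later point z gives this vector norm at least ‖f z‖. Hence the upper right derivative of ‖f‖
    -- is at most 0.
    have h4 : ‖slope f x z - P (f z)‖ * (z - x) = ‖f z - ((z - x : ℝ) : ℂ) • P (f z) - f x‖ := by
      rw [← abs_of_pos hxz', ← Real.norm_eq_abs, mul_comm, ← norm_smul, smul_sub,
        sub_smul_slope, vsub_eq_sub, Real.norm_eq_abs, abs_of_pos hxz', Complex.coe_smul]
      congr 1
      abel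
    rw [h4]
    have h5 := hP (f z) (z - x) hxz'.le
    have h6 := norm_sub_norm_le (f z - ((z - x : ℝ) : ℂ) • P (f z)) (f x)
    simp only [Function.comp]
    linarith
  refine le_of_forall_pos_le_add fun η hη => ?_
  -- The comparison principle needs a strictly positive boundary slope. The slack η/(t+1) adds at
  -- most η by time t, including t = 0.
  have key := image_norm_le_of_liminf_right_slope_norm_lt_deriv_boundary (f' := fun _ => 0)
    (B := fun s => ‖A‖ + η / (t + 1) * s) (B' := fun _ => η / (t + 1)) hc.continuousOn hslope
    (by simp [hf0]) (by fun_prop)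
    (fun x _ => by
      simpa using (((hasDerivAt_id x).const_mul (η / (t + 1))).const_add ‖A‖).hasDerivWithinAt)
    (fun x _ _ => by positivity) (right_mem_Icc.2 ht)
  refine key.trans ?_
  have : η / (t + 1) * t ≤ η := by
    rw [div_mul_eq_mul_div, div_le_iff₀ (by positivity)]
    nlinarith
  linarith

end Contraction

/-! ### Lindblad terms at a norm-attaining vector -/

section HilbertSpace

variable {V : Type*} [NormedAddCommGroup V] [InnerProductSpace ℂ V] [CompleteSpace V]

open ContinuousLinearMap

/-- Expanding, ‖A*Aψ - ‖A‖²ψ‖² = ‖A*Aψ‖² - 2‖A‖²‖Aψ‖² + ‖A‖⁴‖ψ‖² ≤ (1 - 2 + 1)‖A‖⁴‖ψ‖² = 0. -/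
theorem adjoint_apply_apply_of_norm_eq {A : V →L[ℂ] V} {ψ : V} (hψ : ‖A ψ‖ = ‖A‖ * ‖ψ‖) :
    adjoint A (A ψ) = ((‖A‖ ^ 2 : ℝ) : ℂ) • ψ := by
  rw [← sub_eq_zero, ← norm_eq_zero, ← sq_eq_zero_iff]
  refine le_antisymm ?_ (sq_nonneg _)
  rw [@norm_sub_sq ℂ, inner_smul_right, adjoint_inner_left, norm_smul]
  have h1 : RCLike.re (((‖A‖ ^ 2 : ℝ) : ℂ) * inner ℂ (A ψ) (A ψ)) = ‖A‖ ^ 2 * ‖A ψ‖ ^ 2 := by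
    rw [inner_self_eq_norm_sq_to_K]
    norm_cast
    exact (congrArg Complex.re (Complex.ofReal_mul _ _).symm).trans (Complex.ofReal_re _)
  have h2 : ‖adjoint A (A ψ)‖ ≤ ‖A‖ * ‖A ψ‖ := by
    simpa using (adjoint A).le_opNorm (A ψ)
  have h3 : ‖((‖A‖ ^ 2 : ℝ) : ℂ)‖ = ‖A‖ ^ 2 := by
    rw [Complex.norm_real, Real.norm_of_nonneg (by positivity)]
  rw [h1, h3, hψ]
  rw [hψ] at h2
  have h4 := pow_le_pow_left₀ (norm_nonneg _) h2 2
  nlinarith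

/-- Moving A to the left turns the inner product into i(⟨Aψ, HAψ⟩ - ‖A‖²⟨ψ, Hψ⟩), where both
expectations are real. -/
theorem re_inner_commutator_eq_zero {A H : V →L[ℂ] V} (hH : adjoint H = H) {ψ : V}
    (hψ : ‖A ψ‖ = ‖A‖ * ‖ψ‖) :
    (inner ℂ (A ψ) (Complex.I • (H (A ψ) - A (H ψ)))).re = 0 := by
  have hsymm : ∀ φ : V, (inner ℂ φ (H φ)).im = 0 := fun φ => by
    have h : inner ℂ φ (H φ) = starRingEnd ℂ (inner ℂ φ (H φ)) := by
      rw [inner_conj_symm]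
      conv_lhs => rw [← hH, adjoint_inner_right]
    exact Complex.conj_eq_iff_im.1 h.symm
  rw [inner_smul_right, inner_sub_right, ← adjoint_inner_left A, adjoint_apply_apply_of_norm_eq hψ,
    inner_smul_left, Complex.conj_ofReal]
  simp [hsymm, -Complex.ofReal_pow]

/-- The anticommutator contributes -½(‖KAψ‖² + ‖A‖²‖Kψ‖²), which dominates the cross term Re⟨KAψ,
AKψ⟩ by Cauchy–Schwarz and AM–GM. -/
theorem re_inner_jump_le_zero (A K : V →L[ℂ] V) {ψ : V} (hψ : ‖A ψ‖ = ‖A‖ * ‖ψ‖) :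
    (inner ℂ (A ψ) (adjoint K (A (K ψ)) -
      (1 / 2 : ℂ) • (adjoint K (K (A ψ)) + A (adjoint K (K ψ))))).re ≤ 0 := by
  rw [inner_sub_right, inner_smul_right, inner_add_right, ← adjoint_inner_left A,
    adjoint_apply_apply_of_norm_eq hψ, inner_smul_left, Complex.conj_ofReal,
    adjoint_inner_right, adjoint_inner_right, adjoint_inner_right, inner_self_eq_norm_sq_to_K,
    inner_self_eq_norm_sq_to_K]
  have h1 : (inner ℂ (K (A ψ)) (A (K ψ))).re ≤ ‖K (A ψ)‖ * (‖A‖ * ‖K ψ‖) :=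
    (Complex.re_le_norm _).trans ((norm_inner_le_norm _ _).trans
      (by gcongr; exact A.le_opNorm _))
  have h2 : ((1 / 2 : ℂ) * ((‖K (A ψ)‖ : ℂ) ^ 2 + ((‖A‖ ^ 2 : ℝ) : ℂ) * (‖K ψ‖ : ℂ) ^ 2)).re =
      1 / 2 * (‖K (A ψ)‖ ^ 2 + ‖A‖ ^ 2 * ‖K ψ‖ ^ 2) := by
    rw [← Complex.ofReal_re (1 / 2 * (‖K (A ψ)‖ ^ 2 + ‖A‖ ^ 2 * ‖K ψ‖ ^ 2))]
    push_cast
    rfl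
  have h3 := sq_nonneg (‖K (A ψ)‖ - ‖A‖ * ‖K ψ‖)
  have h4 : ∀ z w : ℂ, (z - w).re = z.re - w.re := Complex.sub_re
  rw [h4]
  erw [h2]
  nlinarith

end HilbertSpace

/-! ### Dissipativity of sums of Lindblad generators -/

section MatrixContraction

variable {m : Type*} [Fintype m] [DecidableEq m]

/-- The real part of `⟨Aψ, Φ(A)ψ⟩` is non-positive whenever `A` attains its norm at `ψ`. -/
def IsAccretiveNeg (Φ : Matrix m m ℂ →ₗ[ℂ] Matrix m m ℂ) : Prop :=
  ∀ (A : Matrix m m ℂ) (ψ : EuclideanSpace ℂ m),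
    ‖Matrix.toEuclideanCLM (n := m) (𝕜 := ℂ) A ψ‖ = ‖A‖ * ‖ψ‖ →
    (inner ℂ (Matrix.toEuclideanCLM (n := m) (𝕜 := ℂ) A ψ)
      (Matrix.toEuclideanCLM (n := m) (𝕜 := ℂ) (Φ A) ψ)).re ≤ 0

theorem IsLindblad.isAccretiveNeg {Φ : Matrix m m ℂ →ₗ[ℂ] Matrix m m ℂ} (hΦ : IsLindblad Φ) :
    IsAccretiveNeg Φ := by
  obtain ⟨H, ℓ, K, hH, hK⟩ := hΦ
  intro A ψ hψ
  rw [← Matrix.l2_opNorm_toEuclideanCLM] at hψ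
  rw [hK]
  simp only [map_add, map_smul, map_sub, map_sum, map_mul, map_star,
    ContinuousLinearMap.star_eq_adjoint, add_apply, sum_apply,
    sub_apply, smul_apply, mul_apply_eq_comp,
    inner_add_right, inner_sum, Complex.add_re, Complex.re_sum]
  refine add_nonpos (le_of_eq ?_) (Finset.sum_nonpos fun j _ => ?_)
  · refine re_inner_commutator_eq_zero ?_ hψ
    rw [← ContinuousLinearMap.star_eq_adjoint, ← map_star, hH]
  · exact re_inner_jump_le_zero _ _ hψ

/-- The sign condition is linear in Φ, so it passes to sums directly; this is why it is used in
place of dissipativity itself. -/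
theorem isAccretiveNeg_sum {κ : Type*} (S : Finset κ)
    {Φ : κ → Matrix m m ℂ →ₗ[ℂ] Matrix m m ℂ} (h : ∀ k ∈ S, IsAccretiveNeg (Φ k)) :
    IsAccretiveNeg (∑ k ∈ S, Φ k) := by
  intro A ψ hψ
  simp only [LinearMap.sum_apply, map_sum, sum_apply, inner_sum, Complex.re_sum]
  exact Finset.sum_nonpos fun k hk => h k hk A ψ hψ

theorem exists_norm_eq_opNorm {V : Type*} [NormedAddCommGroup V] [NormedSpace ℂ V]
    [FiniteDimensional ℂ V] [Nontrivial V] (T : V →L[ℂ] V) : ∃ ψ : V, ‖ψ‖ = 1 ∧ ‖T ψ‖ = ‖T‖ := by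
  have := FiniteDimensional.proper ℂ V
  obtain ⟨ψ, hψ, hmax⟩ := (isCompact_sphere (0 : V) 1).exists_isMaxOn
    (NormedSpace.sphere_nonempty.2 zero_le_one) (T.continuous.norm.continuousOn)
  have hψ1 : ‖ψ‖ = 1 := by simpa using hψ
  refine ⟨ψ, hψ1, le_antisymm (by simpa [hψ1] using T.le_opNorm ψ) ?_⟩
  refine T.opNorm_le_of_unit_norm (norm_nonneg _) fun x hx => hmax (by simpa using hx)

/-- At a unit vector ψ where A attains its norm, ‖A‖² ≤ Re⟨Aψ, (A - cΦ(A))ψ⟩ ≤ ‖A‖ ‖A - cΦ(A)‖. -/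
theorem IsAccretiveNeg.isDissipative {Φ : Matrix m m ℂ →ₗ[ℂ] Matrix m m ℂ}
    (hΦ : IsAccretiveNeg Φ) : IsDissipative (LinearMap.toContinuousLinearMap Φ) := by
  intro A c hc
  rcases isEmpty_or_nonempty m with hm | hm
  · rw [Subsingleton.elim A 0]
    simp
  obtain ⟨ψ, hψ1, hψ⟩ := exists_norm_eq_opNorm (Matrix.toEuclideanCLM (n := m) (𝕜 := ℂ) A)
  rw [Matrix.l2_opNorm_toEuclideanCLM] at hψ
  have h1 := hΦ A ψ (by rw [hψ, hψ1, mul_one])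
  set T := Matrix.toEuclideanCLM (n := m) (𝕜 := ℂ) with hT
  have h2 : ‖A‖ ^ 2 ≤ (inner ℂ (T A ψ) (T (A - (c : ℂ) • Φ A) ψ)).re := by
    rw [map_sub, map_smul, sub_apply, smul_apply,
      inner_sub_right, inner_smul_right, inner_self_eq_norm_sq_to_K, hψ, Complex.sub_re,
      Complex.re_ofReal_mul]
    have : (((‖A‖ : ℝ) : ℂ) ^ 2).re = ‖A‖ ^ 2 := by norm_cast
    erw [this]
    nlinarith
  have h3 : (inner ℂ (T A ψ) (T (A - (c : ℂ) • Φ A) ψ)).re ≤ ‖A‖ * ‖A - (c : ℂ) • Φ A‖ := by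
    refine (Complex.re_le_norm _).trans ((norm_inner_le_norm _ _).trans ?_)
    rw [hψ]
    gcongr
    refine ((T (A - (c : ℂ) • Φ A)).le_opNorm ψ).trans (le_of_eq ?_)
    rw [hψ1, mul_one]
    exact Matrix.l2_opNorm_toEuclideanCLM _
  rcases (norm_nonneg A).eq_or_lt with h0 | h0
  · rw [← h0]
    exact norm_nonneg _
  · have := h2.trans h3
    rw [sq] at this
    exact le_of_mul_le_mul_left this h0

end MatrixContraction

end OpenSpin

namespace OpenSpin

/-! ### Duhamel estimates -/

section Duhamel

open Filter Topology Set

variable {E : Type*} [NormedAddCommGroup E] [NormedSpace ℂ E] [CompleteSpace E]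

theorem hasDerivAt_exp_mul_exp (P Q R : E →L[ℂ] E) (t s : ℝ) :
    HasDerivAt (fun s : ℝ => NormedSpace.exp (((t - s : ℝ) : ℂ) • P) *
        (Q * NormedSpace.exp ((s : ℂ) • R)))
      (NormedSpace.exp (((t - s : ℝ) : ℂ) • P) *
        ((Q * R - P * Q) * NormedSpace.exp ((s : ℂ) • R))) s := by
  have h1 : HasDerivAt (fun s : ℝ => NormedSpace.exp (((t - s : ℝ) : ℂ) • P))
      (-(NormedSpace.exp (((t - s : ℝ) : ℂ) • P) * P)) s := by
    have h2 := (hasDerivAt_exp_smul_const (𝕂 := ℂ) P ((t - s : ℝ) : ℂ)).scomp (t - s)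
      Complex.ofRealCLM.hasDerivAt
    have h3 := h2.scomp s ((hasDerivAt_id s).const_sub t)
    refine HasDerivAt.congr_deriv (f' := _) h3 ?_
    simp
  refine (h1.mul ((hasDerivAt_exp_smul R s).const_mul Q)).congr_deriv ?_
  noncomm_ring

/-- The path s ↦ exp((t-s)P) Q exp(sR) a joins the two vectors, and its derivative is exp((t-s)P)(QR
- PQ) exp(sR) a. Contractivity removes the first factor, and comparison with a primitive b replaces
integration. -/
theorem norm_duhamel_le {P Q R : E →L[ℂ] E}
    (hP : ∀ s : ℝ, 0 ≤ s → ∀ A, ‖NormedSpace.exp ((s : ℂ) • P) A‖ ≤ ‖A‖) {t : ℝ} (ht : 0 ≤ t)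
    (a : E) {b b' : ℝ → ℝ} (hb : ∀ s, HasDerivAt b (b' s) s) (hb0 : b 0 = 0)
    (hbound : ∀ s : ℝ, 0 ≤ s → ‖(Q * R - P * Q) (NormedSpace.exp ((s : ℂ) • R) a)‖ ≤ b' s) :
    ‖Q (NormedSpace.exp ((t : ℂ) • R) a) - NormedSpace.exp ((t : ℂ) • P) (Q a)‖ ≤ b t := by
  have hd : ∀ s, HasDerivAt (fun s : ℝ => NormedSpace.exp (((t - s : ℝ) : ℂ) • P)
        (Q (NormedSpace.exp ((s : ℂ) • R) a)) - NormedSpace.exp ((t : ℂ) • P) (Q a))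
      (NormedSpace.exp (((t - s : ℝ) : ℂ) • P)
        ((Q * R - P * Q) (NormedSpace.exp ((s : ℂ) • R) a))) s := fun s => by
    have h := ((ContinuousLinearMap.apply ℂ E a).hasFDerivAt.restrictScalars ℝ
      |>.comp_hasDerivAt s (hasDerivAt_exp_mul_exp P Q R t s))
    exact HasDerivAt.sub_const _ h
  have key := image_norm_le_of_norm_deriv_right_le_deriv_boundary (a := 0) (b := t)
    (continuous_iff_continuousAt.2 fun s => (hd s).continuousAt).continuousOn
    (fun s _ => (hd s).hasDerivWithinAt) (by simp [hb0]) hb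
    (fun s hs => (hP _ (sub_nonneg.2 hs.2.le) _).trans (hbound s hs.1)) (right_mem_Icc.2 ht)
  simpa using key

end Duhamel

/-! ### The Lieb–Robinson estimate -/

section Propagation

open Finset

variable {Γ : Type*} [DecidableEq Γ]

/-- `h ↦ M h` for the kernel `M(z, y) = ∑_{Z ∈ S, Z ∋ z, y} ℓ(Z)`. -/
def propagate (ℓ : Finset Γ → ℝ) (S : Finset (Finset Γ)) : (Γ → ℝ) →ₗ[ℝ] (Γ → ℝ) where
  toFun h z := ∑ Z ∈ S with z ∈ Z, ℓ Z * ∑ y ∈ Z, h y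
  map_add' h h' := by
    ext z
    simp [sum_add_distrib, mul_add]
  map_smul' c h := by
    ext z
    simp only [Pi.smul_apply, smul_eq_mul, ← mul_sum, mul_left_comm _ c, RingHom.id_apply]

theorem propagate_apply (ℓ : Finset Γ → ℝ) (S : Finset (Finset Γ)) (h : Γ → ℝ) (z : Γ) :
    propagate ℓ S h z = ∑ Z ∈ S with z ∈ Z, ℓ Z * ∑ y ∈ Z, h y := rfl

/-- The sum of the weights of the sets of `S` that meet `T` is at most the sum over the points
of `T`. -/
theorem sum_filter_not_disjoint_le (S : Finset (Finset Γ)) (T : Finset Γ) {c : Finset Γ → ℝ}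
    (hc : ∀ Z ∈ S, 0 ≤ c Z) :
    ∑ Z ∈ S with ¬Disjoint T Z, c Z ≤ ∑ z ∈ T, ∑ Z ∈ S with z ∈ Z, c Z := by
  simp only [sum_filter]
  rw [sum_comm]
  refine sum_le_sum fun Z hZ => ?_
  have hnn : ∀ z ∈ T, 0 ≤ if z ∈ Z then c Z else 0 := fun z _ => by
    split_ifs
    exacts [hc Z hZ, le_rfl]
  split_ifs with h
  · exact sum_nonneg hnn
  · obtain ⟨z, hz, hzZ⟩ := not_disjoint_iff.1 h
    refine le_trans ?_ (single_le_sum hnn hz)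
    rw [if_pos hzZ]

/-- The indicator function of `X`. -/
def indicatorFun (X : Finset Γ) (z : Γ) : ℝ := if z ∈ X then 1 else 0

/-- The `n`-th order truncation of `exp(t M) 1_X`, with a remainder. -/
noncomputable def propagationBound (M : (Γ → ℝ) →ₗ[ℝ] (Γ → ℝ)) (X : Finset Γ) (n : ℕ) (t : ℝ) : Γ → ℝ :=
  ∑ k ∈ range n, (t ^ k / k.factorial) • (M ^ k) (indicatorFun X) +
    (t ^ n / n.factorial) • (M ^ n) 1

/-- This recursion drives the Picard iteration: integrating M applied to the order-n bound yields
the order-(n+1) bound. -/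
theorem hasDerivAt_propagationBound (M : (Γ → ℝ) →ₗ[ℝ] (Γ → ℝ)) (X : Finset Γ) (n : ℕ) (t : ℝ)
    (z : Γ) : HasDerivAt (fun t => propagationBound M X (n + 1) t z)
      (M (propagationBound M X n t) z) t := by
  have hpow : ∀ k : ℕ, HasDerivAt (fun t : ℝ => t ^ (k + 1) / (k + 1).factorial)
      (t ^ k / k.factorial) t := fun k => by
    refine ((hasDerivAt_pow (k + 1) t).div_const _).congr_deriv ?_
    rw [Nat.factorial_succ]
    push_cast
    field_simp
  have hM : ∀ k (h : Γ → ℝ), M ((M ^ k) h) = (M ^ (k + 1)) h := fun k h => by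
    rw [pow_succ', Module.End.mul_apply]
  have h1 : M (propagationBound M X n t) z =
      ∑ k ∈ range n, t ^ k / k.factorial * (M ^ (k + 1)) (indicatorFun X) z +
        t ^ n / n.factorial * (M ^ (n + 1)) 1 z := by
    simp [propagationBound, hM]
  have h2 : (fun t => propagationBound M X (n + 1) t z) = fun t =>
      (∑ k ∈ range n, t ^ (k + 1) / (k + 1).factorial * (M ^ (k + 1)) (indicatorFun X) z +
        indicatorFun X z) + t ^ (n + 1) / (n + 1).factorial * (M ^ (n + 1)) 1 z := by
    ext t
    simp [propagationBound, sum_range_succ' _ n]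
  rw [h1, h2]
  exact ((HasDerivAt.fun_sum fun k _ => (hpow k).mul_const _).add_const _).add
    ((hpow n).mul_const _)

theorem propagationBound_succ_zero (M : (Γ → ℝ) →ₗ[ℝ] (Γ → ℝ)) (X : Finset Γ) (n : ℕ) (z : Γ) :
    propagationBound M X (n + 1) 0 z = indicatorFun X z := by
  simp [propagationBound, sum_range_succ' _ n]

end Propagation

/-! ### Lieb–Robinson bound and comparison of dynamics for abstract local families -/

section LiebRobinson

open Finset

variable {Γ : Type*} [DecidableEq Γ]
  {E : Type*} [NormedAddCommGroup E] [NormedSpace ℂ E] [CompleteSpace E]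

/-- A family of bounded operators labelled by the sets of `U`, commuting when the labels are
disjoint, all of whose partial sums generate contraction semigroups. -/
structure IsLocalFamily (U : Finset (Finset Γ)) (D : Finset Γ → E →L[ℂ] E) (ℓ : Finset Γ → ℝ) :
    Prop where
  nonneg : ∀ Z ∈ U, 0 ≤ ℓ Z
  norm_le : ∀ Z ∈ U, ∀ A, ‖D Z A‖ ≤ ℓ Z * ‖A‖
  empty : D ∅ = 0
  commute : ∀ Z ∈ U, ∀ Z' ∈ U, Disjoint Z Z' → Commute (D Z) (D Z')
  contraction : ∀ S ⊆ U, ∀ t : ℝ, 0 ≤ t → ∀ A,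
    ‖NormedSpace.exp ((t : ℂ) • ∑ Z ∈ S, D Z) A‖ ≤ ‖A‖

variable {U : Finset (Finset Γ)} {D : Finset Γ → E →L[ℂ] E} {ℓ : Finset Γ → ℝ}

/-- Let P keep only the terms of the generator R disjoint from Z. These commute with D_Z, so Duhamel
with Q = D_Z leaves only products D_Z D_{Z'} with Z' meeting Z, to which the bound of the previous
order applies. Order 0 is contractivity. -/
theorem IsLocalFamily.lieb_robinson (hD : IsLocalFamily U D ℓ) {S S' : Finset (Finset Γ)}
    (hS : S ⊆ S') (hS' : S' ⊆ U) {X : Finset Γ} {a : E}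
    (ha : ∀ Z ∈ U, Disjoint Z X → D Z a = 0) (n : ℕ) :
    ∀ Z ∈ U, ∀ t : ℝ, 0 ≤ t → ‖D Z (NormedSpace.exp ((t : ℂ) • ∑ Z ∈ S, D Z) a)‖ ≤
      ℓ Z * ‖a‖ * ∑ z ∈ Z, propagationBound (propagate ℓ S') X n t z := by
  induction n with
  | zero =>
    intro Z hZ t ht
    rcases Z.eq_empty_or_nonempty with rfl | hne
    · simp [hD.empty]
    refine (hD.norm_le Z hZ _).trans ?_
    have h1 : (1 : ℝ) ≤ Z.card := by exact_mod_cast hne.card_pos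
    have h2 := hD.contraction S (hS.trans hS') t ht a
    have h3 := hD.nonneg Z hZ
    simp only [propagationBound, range_zero, sum_empty, pow_zero, Nat.factorial_zero, Nat.cast_one,
      div_one, one_smul, zero_add, Module.End.one_apply, Pi.one_apply, sum_const, nsmul_eq_mul,
      mul_one]
    calc _ ≤ ℓ Z * ‖a‖ := by gcongr
      _ ≤ ℓ Z * ‖a‖ * Z.card := le_mul_of_one_le_right (by positivity) h1
  | succ n ih =>
    intro Z hZ t ht
    have hℓ := hD.nonneg Z hZ
    set R := ∑ Z ∈ S, D Z with hR
    set P := ∑ Z' ∈ S with Disjoint Z Z', D Z' with hP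
    have hW : D Z * R - P * D Z = ∑ Z' ∈ S with ¬Disjoint Z Z', D Z * D Z' := by
      have hc : P * D Z = D Z * P := by
        rw [hP, sum_mul, mul_sum]
        refine sum_congr rfl fun Z' hZ' => ?_
        rw [mem_filter] at hZ'
        exact (hD.commute Z hZ Z' (hS' (hS hZ'.1)) hZ'.2).eq.symm
      rw [hc, ← mul_sub, hR, hP, ← sum_filter_add_sum_filter_not S (Disjoint Z),
        add_sub_cancel_left, mul_sum]
    have key := norm_duhamel_le (P := P) (Q := D Z) (R := R)
      (hD.contraction _ ((filter_subset _ _).trans (hS.trans hS'))) ht a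
      -- Subtracting the indicator makes b vanish at 0. It is restored by the bound on exp(tP) D_Z
      -- a, which vanishes when Z misses X.
      (b := fun s => ℓ Z * ‖a‖ * ∑ z ∈ Z,
        (propagationBound (propagate ℓ S') X (n + 1) s z - indicatorFun X z))
      (fun s => (HasDerivAt.fun_sum fun z _ =>
        (hasDerivAt_propagationBound (propagate ℓ S') X n s z).sub_const _).const_mul _)
      (by simp [propagationBound_succ_zero]) ?_
    · have h0 : ‖NormedSpace.exp ((t : ℂ) • P) (D Z a)‖ ≤
          ℓ Z * ‖a‖ * ∑ z ∈ Z, indicatorFun X z := by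
        refine (hD.contraction _ ((filter_subset _ _).trans (hS.trans hS')) t ht _).trans ?_
        have hnn : ∀ z ∈ Z, 0 ≤ indicatorFun X z := fun z _ => by
          unfold indicatorFun
          split_ifs <;> norm_num
        by_cases hd : Disjoint Z X
        · rw [ha Z hZ hd, norm_zero]
          exact mul_nonneg (by positivity) (sum_nonneg hnn)
        · obtain ⟨z, hz, hzX⟩ := not_disjoint_iff.1 hd
          refine (hD.norm_le Z hZ a).trans (le_mul_of_one_le_right (by positivity) ?_)
          refine le_trans ?_ (single_le_sum hnn hz)
          simp [indicatorFun, hzX]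
      have h1 := norm_sub_norm_le (D Z (NormedSpace.exp ((t : ℂ) • R) a))
        (NormedSpace.exp ((t : ℂ) • P) (D Z a))
      rw [sum_sub_distrib, mul_sub] at key
      linarith
    · intro s hs
      have hB : ∀ Z' ∈ S',
          0 ≤ ℓ Z' * ‖a‖ * ∑ y ∈ Z', propagationBound (propagate ℓ S') X n s y :=
        fun Z' hZ' => (norm_nonneg _).trans (ih Z' (hS' hZ') s hs)
      rw [hW, _root_.sum_apply]
      calc _ ≤ ∑ Z' ∈ S with ¬Disjoint Z Z', ℓ Z * (ℓ Z' * ‖a‖ *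
              ∑ y ∈ Z', propagationBound (propagate ℓ S') X n s y) := by
            refine (norm_sum_le _ _).trans (sum_le_sum fun Z' hZ' => ?_)
            exact (hD.norm_le Z hZ _).trans (mul_le_mul_of_nonneg_left
              (ih Z' (hS' (hS (mem_filter.1 hZ').1)) s hs) hℓ)
        _ ≤ ℓ Z * ∑ Z' ∈ S' with ¬Disjoint Z Z', ℓ Z' * ‖a‖ *
              ∑ y ∈ Z', propagationBound (propagate ℓ S') X n s y := by
            rw [← mul_sum]
            refine mul_le_mul_of_nonneg_left ?_ hℓ
            exact sum_le_sum_of_subset_of_nonneg (filter_subset_filter _ hS)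
              fun Z' hZ' _ => hB Z' (mem_filter.1 hZ').1
        _ ≤ ℓ Z * ∑ z ∈ Z, ∑ Z' ∈ S' with z ∈ Z', ℓ Z' * ‖a‖ *
              ∑ y ∈ Z', propagationBound (propagate ℓ S') X n s y :=
            mul_le_mul_of_nonneg_left (sum_filter_not_disjoint_le S' Z hB) hℓ
        _ = _ := by
            simp only [propagate_apply, mul_assoc, mul_left_comm _ ‖a‖, ← mul_sum]

/-- Comparison of the full dynamics with the dynamics generated by the labels in `S` contained
in `Y`. -/
theorem IsLocalFamily.norm_sub_le_of_subset (hD : IsLocalFamily U D ℓ) {S : Finset (Finset Γ)}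
    (hS : S ⊆ U) {Λ X Y : Finset Γ} (hU : ∀ Z ∈ U, Z ⊆ Λ) (hXY : X ⊆ Y) {a : E}
    (ha : ∀ Z ∈ U, Disjoint Z X → D Z a = 0) (n : ℕ) {t : ℝ} (ht : 0 ≤ t) :
    ‖NormedSpace.exp ((t : ℂ) • ∑ Z ∈ U, D Z) a -
        NormedSpace.exp ((t : ℂ) • ∑ Z ∈ S with Z ⊆ Y, D Z) a‖ ≤
      ‖a‖ * (t * ∑ Z ∈ U with Z ∉ S ∧ ¬Disjoint Y Z, ℓ Z +
        ∑ y ∈ Λ \ Y, propagationBound (propagate ℓ S) X (n + 1) t y) := by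
  set R := ∑ Z ∈ S with Z ⊆ Y, D Z with hR
  have hSY : (S.filter (· ⊆ Y)) ⊆ U := (filter_subset _ _).trans hS
  have hW : (1 : E →L[ℂ] E) * R - (∑ Z ∈ U, D Z) * 1 =
      -∑ Z ∈ U with ¬(Z ∈ S ∧ Z ⊆ Y), D Z := by
    have h1 : S.filter (· ⊆ Y) = U.filter (fun Z => Z ∈ S ∧ Z ⊆ Y) := by
      ext Z
      simp only [mem_filter]
      exact ⟨fun h => ⟨hS h.1, h⟩, fun h => h.2⟩
    rw [one_mul, mul_one, hR, h1, ← sum_filter_add_sum_filter_not U (fun Z => Z ∈ S ∧ Z ⊆ Y),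
      sub_add_cancel_left]
  -- Such D_Z commutes with every term generating the dynamics inside Y, and it annihilates a.
  have hfar : ∀ Z ∈ U, Disjoint Y Z → ∀ s : ℝ, D Z (NormedSpace.exp ((s : ℂ) • R) a) = 0 := by
    intro Z hZ hYZ s
    have hc : Commute (D Z) (NormedSpace.exp ((s : ℂ) • R)) := by
      refine Commute.exp_right (Commute.smul_right (Commute.sum_right _ _ _ fun Z' hZ' => ?_) _)
      exact hD.commute Z hZ Z' (hSY hZ')
        (hYZ.symm.mono_right (mem_filter.1 hZ').2)
    have := congrArg (fun T : E →L[ℂ] E => T a) hc.eq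
    simp only [mul_apply_eq_comp] at this
    rw [this, ha Z hZ (hYZ.symm.mono_right hXY), map_zero]
  have hB : ∀ s : ℝ, 0 ≤ s → ∀ Z ∈ S,
      0 ≤ ℓ Z * ‖a‖ * ∑ y ∈ Z, propagationBound (propagate ℓ S) X n s y := fun s hs Z hZ =>
    (norm_nonneg _).trans (hD.lieb_robinson (S := S.filter (· ⊆ Y)) (filter_subset _ _) hS ha n Z (hS hZ) s hs)
  have key := norm_duhamel_le (P := ∑ Z ∈ U, D Z) (Q := 1) (R := R)
    (hD.contraction U subset_rfl) ht a
    (b := fun s => ‖a‖ * (s * ∑ Z ∈ U with Z ∉ S ∧ ¬Disjoint Y Z, ℓ Z +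
      ∑ y ∈ Λ \ Y, propagationBound (propagate ℓ S) X (n + 1) s y))
    (fun s => ((((hasDerivAt_id s).mul_const _).add (HasDerivAt.fun_sum fun y _ =>
      hasDerivAt_propagationBound (propagate ℓ S) X n s y)).const_mul _)) ?_ ?_
  · rw [← norm_sub_rev]
    simpa using key
  · simp only [zero_mul, zero_add, propagationBound_succ_zero]
    rw [sum_eq_zero, mul_zero]
    intro y hy
    rw [indicatorFun, if_neg fun hyX => (mem_sdiff.1 hy).2 (hXY hyX)]
  · intro s hs
    rw [hW, _root_.neg_apply, norm_neg, _root_.sum_apply]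
    -- A discarded set outside S is bounded trivially if it meets Y and vanishes otherwise. A
    -- discarded set in S has a point in Λ \ Y and is bounded by Lieb–Robinson.
    have hsplit : ∑ Z ∈ U with ¬(Z ∈ S ∧ Z ⊆ Y), ‖D Z (NormedSpace.exp ((s : ℂ) • R) a)‖ ≤
        ∑ Z ∈ U with Z ∉ S ∧ ¬Disjoint Y Z, ‖a‖ * ℓ Z +
        ∑ Z ∈ S with ¬Disjoint (Λ \ Y) Z,
          ℓ Z * ‖a‖ * ∑ y ∈ Z, propagationBound (propagate ℓ S) X n s y := by
      have h1 : S.filter (fun Z => ¬Disjoint (Λ \ Y) Z) =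
          U.filter (fun Z => Z ∈ S ∧ ¬Disjoint (Λ \ Y) Z) := by
        ext Z
        simp only [mem_filter]
        exact ⟨fun h => ⟨hS h.1, h⟩, fun h => h.2⟩
      rw [h1]
      simp only [sum_filter]
      rw [← sum_add_distrib]
      refine sum_le_sum fun Z hZ => ?_
      have hℓ := hD.nonneg Z hZ
      by_cases hZS : Z ∈ S
      · have hB' := hB s hs Z hZS
        by_cases hZY : Z ⊆ Y
        · simp only [hZS, hZY, and_self, not_true, if_false, false_and, true_and, zero_add]
          split_ifs
          exacts [le_rfl, hB']
        · have hm : ¬Disjoint (Λ \ Y) Z := by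
            obtain ⟨y, hy, hyY⟩ := not_subset.1 hZY
            exact not_disjoint_iff.2 ⟨y, mem_sdiff.2 ⟨hU Z hZ hy, hyY⟩, hy⟩
          simp only [hZS, hZY, hm, and_false, not_false_eq_true, if_true, not_true, false_and,
            if_false, zero_add, and_self]
          exact hD.lieb_robinson (filter_subset _ _) hS ha n Z hZ s hs
      · simp only [hZS, false_and, not_false_eq_true, if_true, true_and, if_false, add_zero]
        by_cases hd : Disjoint Y Z
        · rw [hfar Z hZ hd s, norm_zero, if_neg (not_not.2 hd)]
        · rw [if_pos hd, mul_comm]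
          exact (hD.norm_le Z hZ _).trans (mul_le_mul_of_nonneg_left
            (hD.contraction _ hSY s hs a) hℓ)
    refine (norm_sum_le _ _).trans (hsplit.trans ?_)
    have h2 := sum_filter_not_disjoint_le S (Λ \ Y) (hB s hs)
    rw [one_mul, mul_add, mul_sum]
    refine add_le_add le_rfl (h2.trans (le_of_eq ?_))
    simp only [propagate_apply, mul_assoc, mul_left_comm _ ‖a‖, ← mul_sum]

/-- Comparison of the dynamics in `Y` with its part generated by the labels in `S`. -/
theorem IsLocalFamily.norm_sub_le_of_truncation (hD : IsLocalFamily U D ℓ)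
    {S : Finset (Finset Γ)} (hS : S ⊆ U) (Y : Finset Γ) (a : E) {t : ℝ} (ht : 0 ≤ t) :
    ‖NormedSpace.exp ((t : ℂ) • ∑ Z ∈ U with Z ⊆ Y, D Z) a -
        NormedSpace.exp ((t : ℂ) • ∑ Z ∈ S with Z ⊆ Y, D Z) a‖ ≤
      ‖a‖ * (t * ∑ Z ∈ U with Z ∉ S ∧ Z ⊆ Y, ℓ Z) := by
  set R := ∑ Z ∈ S with Z ⊆ Y, D Z with hR
  have hSY : (S.filter (· ⊆ Y)) ⊆ U := (filter_subset _ _).trans hS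
  have hW : (1 : E →L[ℂ] E) * R - (∑ Z ∈ U with Z ⊆ Y, D Z) * 1 =
      -∑ Z ∈ U with Z ∉ S ∧ Z ⊆ Y, D Z := by
    have h1 : S.filter (· ⊆ Y) = (U.filter (· ⊆ Y)).filter (· ∈ S) := by
      ext Z
      simp only [mem_filter]
      exact ⟨fun h => ⟨⟨hS h.1, h.2⟩, h.1⟩, fun h => ⟨h.2, h.1.2⟩⟩
    have h2 : U.filter (fun Z => Z ∉ S ∧ Z ⊆ Y) = (U.filter (· ⊆ Y)).filter (fun Z => Z ∉ S) := by
      ext Z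
      simp only [mem_filter]
      tauto
    rw [one_mul, mul_one, hR, h1, h2, ← sum_filter_add_sum_filter_not (U.filter (· ⊆ Y)) (· ∈ S),
      sub_add_cancel_left]
  have key := norm_duhamel_le (P := ∑ Z ∈ U with Z ⊆ Y, D Z) (Q := 1) (R := R)
    (hD.contraction _ (filter_subset _ _)) ht a
    (b := fun s => ‖a‖ * (s * ∑ Z ∈ U with Z ∉ S ∧ Z ⊆ Y, ℓ Z))
    (fun s => ((hasDerivAt_id s).mul_const _).const_mul _) (by simp) ?_
  · rw [← norm_sub_rev]
    simpa using key
  · intro s hs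
    rw [hW, _root_.neg_apply, norm_neg, _root_.sum_apply, one_mul, mul_sum]
    refine (norm_sum_le _ _).trans (sum_le_sum fun Z hZ => ?_)
    have hZU := (mem_filter.1 hZ).1
    rw [mul_comm]
    exact (hD.norm_le Z hZU _).trans (mul_le_mul_of_nonneg_left (hD.contraction _ hSY s hs a)
      (hD.nonneg Z hZU))

end LiebRobinson
end OpenSpin

namespace OpenSpin

/-! ### Power laws on regular metric spaces -/

section Zeta

open Finset

theorem summable_zetaConst {ε : ℝ} (hε : 0 < ε) :
    Summable fun n : ℕ => 1 / (1 + (n : ℝ)) ^ (1 + ε) := by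
  have h := (summable_nat_add_iff 1).2 (Real.summable_one_div_nat_rpow.2 (by linarith : 1 < 1 + ε))
  refine h.congr fun n => ?_
  push_cast
  rw [add_comm (n : ℝ) 1]

theorem zetaConst_pos {ε : ℝ} (hε : 0 < ε) : 0 < zetaConst ε :=
  (summable_zetaConst hε).tsum_pos (fun n => by positivity) 0 (by positivity)

/-- The tail of the exponential series beyond order `a`, at an argument at most `a / e`. -/
theorem sum_pow_div_factorial_le {a c : ℝ} (ha : 1 ≤ a) (hc : 0 ≤ c) (hca : Real.exp 1 * c ≤ a)
    (n : ℕ) : ∑ k ∈ (range n).filter fun k : ℕ => a < k, c ^ k / k.factorial ≤ c * Real.exp 1 := by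
  have h1 : ∀ k ∈ (range n).filter (fun k : ℕ => a < k),
      c ^ k / k.factorial ≤ c * Real.exp (1 - a) * (a ^ k / k.factorial) := by
    intro k hk
    have hak : a < (k : ℝ) := (mem_filter.1 hk).2
    obtain ⟨j, rfl⟩ : ∃ j, k = j + 1 := Nat.exists_eq_succ_of_ne_zero fun h0 => by
      rw [h0] at hak
      norm_num at hak
      linarith
    -- One factor c is held back so that the final bound is linear in c. The others satisfy c ≤ a/e,
    -- and e^(-j) ≤ e^(1-a) because j + 1 > a.
    have h2 : c ^ j ≤ Real.exp (1 - a) * a ^ j := by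
      have h3 : c ≤ Real.exp (-1) * a := by
        rw [Real.exp_neg, inv_mul_eq_div, le_div_iff₀ (Real.exp_pos 1)]
        linarith
      refine (pow_le_pow_left₀ hc h3 j).trans ?_
      rw [mul_pow, ← Real.exp_nat_mul]
      gcongr
      push_cast at hak
      linarith
    have h5 : c ^ j ≤ Real.exp (1 - a) * a ^ (j + 1) :=
      h2.trans (mul_le_mul_of_nonneg_left (pow_le_pow_right₀ ha j.le_succ) (Real.exp_pos _).le)
    calc c ^ (j + 1) / (j + 1).factorial = c * c ^ j / (j + 1).factorial := by rw [pow_succ']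
      _ ≤ c * (Real.exp (1 - a) * a ^ (j + 1)) / (j + 1).factorial := by gcongr
      _ = _ := by ring
  refine (sum_le_sum h1).trans ?_
  rw [← mul_sum]
  have h4 : ∑ k ∈ (range n).filter fun k : ℕ => a < k, a ^ k / k.factorial ≤ Real.exp a :=
    (sum_le_sum_of_subset_of_nonneg (filter_subset _ _) fun k _ _ => by positivity).trans
      (Real.sum_le_exp_of_nonneg (by linarith) n)
  calc _ ≤ c * Real.exp (1 - a) * Real.exp a := by gcongr
    _ = _ := by rw [mul_assoc, ← Real.exp_add, sub_add_cancel]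

end Zeta

section PowerLaw

open Finset

theorem powerLaw_pos (α : ℝ) {r : ℝ} (hr : 0 ≤ r) : 0 < powerLaw α r := by
  unfold powerLaw
  positivity

theorem powerLaw_zero (α : ℝ) : powerLaw α 0 = 1 := by simp [powerLaw]

theorem powerLaw_add (α β : ℝ) {r : ℝ} (hr : 0 ≤ r) :
    powerLaw (α + β) r = powerLaw α r * powerLaw β r := by
  rw [powerLaw, powerLaw, powerLaw, Real.rpow_add (by positivity), one_div_mul_one_div]

theorem powerLaw_anti {α : ℝ} (hα : 0 ≤ α) {r s : ℝ} (hr : 0 ≤ r) (hrs : r ≤ s) :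
    powerLaw α s ≤ powerLaw α r := by
  unfold powerLaw
  gcongr

/-- The larger of p and q is at least d/2, so its factor is at most 2^α times the power law at d. -/
theorem powerLaw_mul_le {α : ℝ} (hα : 0 ≤ α) {p q d : ℝ} (hp : 0 ≤ p) (hq : 0 ≤ q) (hd : 0 ≤ d)
    (hdpq : d ≤ p + q) :
    powerLaw α p * powerLaw α q ≤ 2 ^ α * powerLaw α d * (powerLaw α p + powerLaw α q) := by
  have key : ∀ s, 0 ≤ s → d ≤ 2 * s → powerLaw α s ≤ 2 ^ α * powerLaw α d := fun s hs hds => by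
    unfold powerLaw
    rw [mul_one_div, le_div_iff₀ (by positivity), one_div_mul_eq_div,
      div_le_iff₀ (by positivity), ← Real.mul_rpow (by positivity) (by positivity)]
    gcongr
    linarith
  have h1 := powerLaw_pos α hp
  have h2 := powerLaw_pos α hq
  have h3 := powerLaw_pos α hd
  have h4 : (0 : ℝ) < 2 ^ α := by positivity
  rcases le_total p q with h | h
  · have := key q hq (by linarith)
    have h5 : powerLaw α p * powerLaw α q ≤ powerLaw α p * (2 ^ α * powerLaw α d) := by gcongr
    have h6 : 0 ≤ 2 ^ α * powerLaw α d * powerLaw α q := by positivity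
    linarith
  · have := key p hp (by linarith)
    have h5 : powerLaw α p * powerLaw α q ≤ (2 ^ α * powerLaw α d) * powerLaw α q := by gcongr
    have h6 : 0 ≤ 2 ^ α * powerLaw α d * powerLaw α p := by positivity
    linarith

variable {Γ : Type*} [MetricSpace Γ] {κ ν : ℝ}

theorem IsRegular.card_le (hreg : IsRegular Γ κ ν) (x : Γ) (n : ℕ) (T : Finset Γ)
    (hT : ∀ y ∈ T, dist y x ≤ (n : ℝ) + 1) : (T.card : ℝ) ≤ κ * ((n : ℝ) + 1) ^ ν := by
  refine le_trans ?_ (hreg x n).2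
  rw [← Set.ncard_coe_finset]
  exact_mod_cast Set.ncard_le_ncard (fun y hy => Metric.mem_closedBall.2 (hT y hy)) (hreg x n).1

/-- The shell n ≤ d < n + 1 has at most κ(n+1)^ν points, each of weight at most (1+n)^(-ν-1-ε). -/
theorem IsRegular.sum_powerLaw_le (hreg : IsRegular Γ κ ν) (hκ : 0 < κ) (hν : 0 < ν) {ε : ℝ}
    (hε : 0 < ε) (x : Γ) (T : Finset Γ) :
    ∑ y ∈ T, powerLaw (ν + (1 + ε)) (dist y x) ≤ κ * zetaConst ε := by
  classical
  rw [← sum_fiberwise_of_maps_to (g := fun y => ⌊dist y x⌋₊)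
    (fun y hy => mem_image_of_mem (fun y => ⌊dist y x⌋₊) hy)]
  have h1 : ∀ n ∈ T.image (fun y => ⌊dist y x⌋₊),
      ∑ y ∈ T with ⌊dist y x⌋₊ = n, powerLaw (ν + (1 + ε)) (dist y x) ≤
        κ * (1 / (1 + (n : ℝ)) ^ (1 + ε)) := by
    intro n _
    have hcard := hreg.card_le x n (T.filter fun y => ⌊dist y x⌋₊ = n) fun y hy => by
      rw [← (mem_filter.1 hy).2]
      exact (Nat.lt_floor_add_one _).le
    calc _ ≤ ∑ y ∈ T with ⌊dist y x⌋₊ = n, powerLaw (ν + (1 + ε)) n := by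
          refine sum_le_sum fun y hy => powerLaw_anti (by linarith) (by positivity) ?_
          rw [← (mem_filter.1 hy).2]
          exact Nat.floor_le dist_nonneg
      _ = (T.filter fun y => ⌊dist y x⌋₊ = n).card * powerLaw (ν + (1 + ε)) n := by
          rw [sum_const, nsmul_eq_mul]
      _ ≤ κ * ((n : ℝ) + 1) ^ ν * powerLaw (ν + (1 + ε)) n := by
          gcongr
          exact (powerLaw_pos _ (by positivity)).le
      _ = _ := by
          rw [powerLaw_add _ _ (by positivity), powerLaw, powerLaw, add_comm (n : ℝ) 1]
          field_simp
  refine (sum_le_sum h1).trans ?_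
  rw [← mul_sum]
  gcongr
  exact (summable_zetaConst hε).sum_le_tsum _ fun n _ => by positivity

theorem IsRegular.sum_powerLaw_tail_le (hreg : IsRegular Γ κ ν) (hκ : 0 < κ) (hν : 0 < ν)
    {ε β s : ℝ} (hε : 0 < ε) (hβ : 0 ≤ β) (hs : 0 ≤ s) (x : Γ) (T : Finset Γ)
    (hT : ∀ y ∈ T, s ≤ dist y x) :
    ∑ y ∈ T, powerLaw (β + (ν + (1 + ε))) (dist y x) ≤ κ * zetaConst ε * powerLaw β s := by
  have h1 : ∀ y ∈ T, powerLaw (β + (ν + (1 + ε))) (dist y x) ≤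
      powerLaw (ν + (1 + ε)) (dist y x) * powerLaw β s := fun y hy => by
    rw [powerLaw_add _ _ dist_nonneg, mul_comm]
    gcongr
    · exact (powerLaw_pos _ dist_nonneg).le
    · exact powerLaw_anti hβ hs (hT y hy)
  refine (sum_le_sum h1).trans ?_
  rw [← sum_mul]
  exact mul_le_mul_of_nonneg_right (hreg.sum_powerLaw_le hκ hν hε x T) (powerLaw_pos _ hs).le

theorem IsRegular.card_inflationIn_le (hreg : IsRegular Γ κ ν) (hκ : 0 < κ) (hν : 0 < ν)
    {r : ℝ} (hr : 1 ≤ r) (Λ X : Finset Γ) :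
    ((inflationIn Λ X r).card : ℝ) ≤ X.card * (κ * (1 + r) ^ ν) := by
  classical
  have hsub : inflationIn Λ X r ⊆ X.biUnion fun x => Λ.filter fun y => dist y x ≤ r := by
    intro y hy
    obtain ⟨hyΛ, x, hx, hxy⟩ := mem_inflationIn.1 hy
    exact mem_biUnion.2 ⟨x, hx, mem_filter.2 ⟨hyΛ, hxy⟩⟩
  have hball : ∀ x : Γ, ((Λ.filter fun y => dist y x ≤ r).card : ℝ) ≤ κ * (1 + r) ^ ν := by
    intro x
    -- Regularity covers integer radii n + 1; rounding r up to ⌈r⌉ ≤ 1 + r explains the base 1 + r.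
    have hc : 0 < ⌈r⌉₊ := Nat.ceil_pos.2 (by linarith)
    obtain ⟨n, hn⟩ := Nat.exists_eq_succ_of_ne_zero hc.ne'
    have hn' : (⌈r⌉₊ : ℝ) = (n : ℝ) + 1 := by rw [hn]; push_cast; ring
    refine (hreg.card_le x n _ fun y hy => ?_).trans ?_
    · rw [← hn']
      exact (mem_filter.1 hy).2.trans (Nat.le_ceil r)
    · rw [← hn']
      gcongr
      rw [add_comm]
      exact (Nat.ceil_lt_add_one (by linarith)).le
  calc ((inflationIn Λ X r).card : ℝ)
      ≤ (X.biUnion fun x => Λ.filter fun y => dist y x ≤ r).card := by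
        exact_mod_cast card_le_card hsub
    _ ≤ ∑ x ∈ X, ((Λ.filter fun y => dist y x ≤ r).card : ℝ) := by
        exact_mod_cast card_biUnion_le
    _ ≤ ∑ _x ∈ X, κ * (1 + r) ^ ν := sum_le_sum fun x _ => hball x
    _ = _ := by rw [sum_const, nsmul_eq_mul]

theorem IsRegular.fSum_ne_top (hreg : IsRegular Γ κ ν) (hκ : 0 < κ) (hν : 0 < ν)
    {ε β : ℝ} (hε : 0 < ε) (hβ : 0 ≤ β) : fSum Γ (powerLaw (β + (ν + (1 + ε)))) ≠ ∞ := by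
  refine ne_top_of_le_ne_top (b := ENNReal.ofReal (κ * zetaConst ε)) ENNReal.ofReal_ne_top
    (iSup_le fun x => ?_)
  rw [ENNReal.tsum_eq_iSup_sum]
  refine iSup_le fun T => ?_
  rw [← ENNReal.ofReal_sum_of_nonneg fun y _ => (powerLaw_pos _ dist_nonneg).le]
  refine ENNReal.ofReal_le_ofReal ?_
  have h := hreg.sum_powerLaw_tail_le hκ hν hε hβ le_rfl x T fun y _ => dist_nonneg
  rw [powerLaw_zero, mul_one] at h
  simpa only [dist_comm x] using h

theorem convConst_ne_top {α : ℝ} (hα : 0 ≤ α) (hF : fSum Γ (powerLaw α) ≠ ∞) :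
    convConst Γ (powerLaw α) ≠ ∞ := by
  refine ne_top_of_le_ne_top
    (b := ENNReal.ofReal (2 ^ α) * (fSum Γ (powerLaw α) + fSum Γ (powerLaw α)))
    (ENNReal.mul_ne_top ENNReal.ofReal_ne_top (ENNReal.add_ne_top.2 ⟨hF, hF⟩))
    (sInf_le fun x y => ?_)
  have hle : ∀ x : Γ, ∑' z : Γ, ENNReal.ofReal (powerLaw α (dist x z)) ≤ fSum Γ (powerLaw α) :=
    le_iSup (fun x : Γ => ∑' z : Γ, ENNReal.ofReal (powerLaw α (dist x z)))
  calc _ ≤ ∑' z : Γ, ENNReal.ofReal (2 ^ α * powerLaw α (dist x y)) *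
          (ENNReal.ofReal (powerLaw α (dist x z)) + ENNReal.ofReal (powerLaw α (dist y z))) := by
        refine ENNReal.tsum_le_tsum fun z => ?_
        rw [← ENNReal.ofReal_mul (powerLaw_pos _ dist_nonneg).le,
          ← ENNReal.ofReal_add (powerLaw_pos _ dist_nonneg).le (powerLaw_pos _ dist_nonneg).le,
          ← ENNReal.ofReal_mul (mul_nonneg (by positivity) (powerLaw_pos _ dist_nonneg).le),
          dist_comm z y]
        refine ENNReal.ofReal_le_ofReal (powerLaw_mul_le hα dist_nonneg dist_nonneg dist_nonneg ?_)
        rw [dist_comm y z]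
        exact dist_triangle x z y
    _ ≤ ENNReal.ofReal (2 ^ α * powerLaw α (dist x y)) *
          (fSum Γ (powerLaw α) + fSum Γ (powerLaw α)) := by
        rw [ENNReal.tsum_mul_left, ENNReal.tsum_add]
        gcongr <;> exact hle _
    _ = _ := by
        rw [ENNReal.ofReal_mul (by positivity)]
        ring

theorem isFFunction_powerLaw {α : ℝ} (hα : 0 ≤ α) (hF : fSum Γ (powerLaw α) ≠ ∞) :
    IsFFunction Γ (powerLaw α) where
  pos _ hr := powerLaw_pos α hr
  antitone _ hr _ _ hrs := powerLaw_anti hα hr hrs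
  summable := hF
  convolution := convConst_ne_top hα hF

/-- Shows that the infima defining `convConst` and `Interaction.fNorm` are themselves admissible
constants. -/
theorem le_sInf_mul_of_forall {s : Set ℝ≥0∞} {a b : ℝ≥0∞} (hb : b ≠ 0) (hb' : b ≠ ∞)
    (h : ∀ C ∈ s, a ≤ C * b) : a ≤ sInf s * b := by
  rw [← ENNReal.div_le_iff hb hb']
  exact le_sInf fun C hC => (ENNReal.div_le_iff hb hb').2 (h C hC)

theorem IsFFunction.sum_conv_le {F : ℝ → ℝ} (hF : IsFFunction Γ F) (x y : Γ) (T : Finset Γ) :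
    ∑ z ∈ T, F (dist x z) * F (dist z y) ≤ (convConst Γ F).toReal * F (dist x y) := by
  have hp : ∀ x y : Γ, 0 < F (dist x y) := fun x y => hF.pos _ dist_nonneg
  have h1 : ∑' z : Γ, ENNReal.ofReal (F (dist x z)) * ENNReal.ofReal (F (dist z y)) ≤
      convConst Γ F * ENNReal.ofReal (F (dist x y)) :=
    le_sInf_mul_of_forall (ENNReal.ofReal_pos.2 (hp x y)).ne' ENNReal.ofReal_ne_top
      fun C hC => hC x y
  have h2 := (ENNReal.sum_le_tsum T).trans h1
  rw [← ENNReal.ofReal_toReal hF.convolution, ← ENNReal.ofReal_mul ENNReal.toReal_nonneg] at h2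
  simp only [← ENNReal.ofReal_mul (hp _ _).le] at h2
  rw [← ENNReal.ofReal_sum_of_nonneg fun z _ => (mul_pos (hp _ _) (hp _ _)).le] at h2
  exact (ENNReal.ofReal_le_ofReal_iff (mul_nonneg ENNReal.toReal_nonneg (hp _ _).le)).1 h2

/-- At coinciding points the single term z = x already gives F(0)² = F(0) = 1. -/
theorem one_le_convConst_toReal [Nonempty Γ] {α : ℝ} (hF : IsFFunction Γ (powerLaw α)) :
    1 ≤ (convConst Γ (powerLaw α)).toReal := by
  obtain ⟨x⟩ := ‹Nonempty Γ›
  simpa [powerLaw_zero] using hF.sum_conv_le x x {x}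

end PowerLaw

/-! ### Decay of the propagation kernel -/

section Kernel

open Finset

variable {Γ : Type*} [DecidableEq Γ] [MetricSpace Γ] {ℓ : Finset Γ → ℝ}
  {S : Finset (Finset Γ)} {Λ : Finset Γ} {F : ℝ → ℝ} {N : ℝ}

theorem propagate_le (hS : ∀ Z ∈ S, Z ⊆ Λ)
    (hN : ∀ x y : Γ, ∑ Z ∈ S with x ∈ Z ∧ y ∈ Z, ℓ Z ≤ N * F (dist x y))
    {h : Γ → ℝ} (hh : ∀ y, 0 ≤ h y) (z : Γ) :
    propagate ℓ S h z ≤ N * ∑ y ∈ Λ, F (dist z y) * h y := by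
  have h1 : propagate ℓ S h z = ∑ y ∈ Λ, (∑ Z ∈ S with z ∈ Z ∧ y ∈ Z, ℓ Z) * h y := by
    simp only [propagate_apply, sum_mul, sum_filter]
    rw [sum_comm]
    refine sum_congr rfl fun Z hZ => ?_
    split_ifs with hz
    · simp only [hz, true_and, ite_mul, zero_mul]
      rw [mul_sum, ← sum_filter, filter_mem_eq_inter, inter_eq_right.2 (hS Z hZ)]
    · simp [hz]
  rw [h1, mul_sum]
  refine sum_le_sum fun y _ => ?_
  rw [← mul_assoc]
  exact mul_le_mul_of_nonneg_right (hN z y) (hh y)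

theorem propagate_nonneg (hℓ : ∀ Z ∈ S, 0 ≤ ℓ Z) {h : Γ → ℝ} (hh : ∀ y, 0 ≤ h y) (z : Γ) :
    0 ≤ propagate ℓ S h z := by
  rw [propagate_apply]
  exact sum_nonneg fun Z hZ => mul_nonneg (hℓ Z (mem_filter.1 hZ).1) (sum_nonneg fun y _ => hh y)

theorem propagate_pow_nonneg (hℓ : ∀ Z ∈ S, 0 ≤ ℓ Z) {h : Γ → ℝ} (hh : ∀ y, 0 ≤ h y) (n : ℕ)
    (z : Γ) : 0 ≤ (propagate ℓ S ^ n) h z := by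
  induction n generalizing z with
  | zero => exact hh z
  | succ n ih =>
    rw [pow_succ', Module.End.mul_apply]
    exact propagate_nonneg hℓ ih z

theorem indicatorFun_nonneg (X : Finset Γ) (z : Γ) : 0 ≤ indicatorFun X z := by
  unfold indicatorFun
  split_ifs <;> norm_num

theorem propagate_pow_indicator_le (hS : ∀ Z ∈ S, Z ⊆ Λ) (hℓ : ∀ Z ∈ S, 0 ≤ ℓ Z) (hN0 : 0 ≤ N)
    (hN : ∀ x y : Γ, ∑ Z ∈ S with x ∈ Z ∧ y ∈ Z, ℓ Z ≤ N * F (dist x y))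
    (hF : ∀ r, 0 ≤ r → 0 ≤ F r) {C : ℝ} (hC0 : 0 ≤ C)
    (hC : ∀ x y : Γ, ∑ z ∈ Λ, F (dist x z) * F (dist z y) ≤ C * F (dist x y))
    {X : Finset Γ} (hX : X ⊆ Λ) (n : ℕ) (z : Γ) :
    (propagate ℓ S ^ (n + 1)) (indicatorFun X) z ≤
      N ^ (n + 1) * C ^ n * ∑ x ∈ X, F (dist z x) := by
  induction n generalizing z with
  | zero =>
    refine (by simpa using propagate_le hS hN (indicatorFun_nonneg X) z :
      (propagate ℓ S ^ (0 + 1)) (indicatorFun X) z ≤ _).trans (le_of_eq ?_)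
    simp only [indicatorFun, mul_ite, mul_one, mul_zero]
    rw [← sum_filter, filter_mem_eq_inter, inter_eq_right.2 hX]
    ring
  | succ n ih =>
    rw [pow_succ' _ (n + 1), Module.End.mul_apply]
    refine (propagate_le hS hN (propagate_pow_nonneg hℓ (indicatorFun_nonneg X) _) z).trans ?_
    calc _ ≤ N * ∑ y ∈ Λ, F (dist z y) * (N ^ (n + 1) * C ^ n * ∑ x ∈ X, F (dist y x)) := by
          gcongr with y _
          · exact hF _ dist_nonneg
          · exact ih y
      _ = N ^ (n + 1 + 1) * C ^ n * ∑ x ∈ X, ∑ y ∈ Λ, F (dist z y) * F (dist y x) := by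
          rw [sum_comm, mul_sum, mul_sum]
          refine sum_congr rfl fun y _ => ?_
          rw [← mul_sum]
          ring
      _ ≤ N ^ (n + 1 + 1) * C ^ n * ∑ x ∈ X, C * F (dist z x) := by
          gcongr with x _
          exact hC z x
      _ = _ := by
          rw [← mul_sum]
          ring

theorem propagate_pow_one_le (hS : ∀ Z ∈ S, Z ⊆ Λ) (hℓ : ∀ Z ∈ S, 0 ≤ ℓ Z) (hN0 : 0 ≤ N)
    (hN : ∀ x y : Γ, ∑ Z ∈ S with x ∈ Z ∧ y ∈ Z, ℓ Z ≤ N * F (dist x y))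
    (hF : ∀ r, 0 ≤ r → 0 ≤ F r) {G : ℝ} (hG0 : 0 ≤ G) (hG : ∀ x : Γ, ∑ y ∈ Λ, F (dist x y) ≤ G)
    (n : ℕ) (z : Γ) : (propagate ℓ S ^ n) 1 z ≤ (N * G) ^ n := by
  induction n generalizing z with
  | zero => simp
  | succ n ih =>
    rw [pow_succ', Module.End.mul_apply]
    refine (propagate_le hS hN (propagate_pow_nonneg hℓ (fun _ => zero_le_one) _) z).trans ?_
    calc _ ≤ N * ∑ y ∈ Λ, F (dist z y) * (N * G) ^ n := by
          gcongr with y _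
          · exact hF _ dist_nonneg
          · exact ih y
      _ ≤ N * (G * (N * G) ^ n) := by
          rw [← sum_mul]
          gcongr
          exact hG z
      _ = _ := by ring

/-- Finite range: one application of the kernel enlarges the support by at most ρ. -/
theorem propagate_pow_indicator_eq_zero {ρ : ℝ}
    (hρ : ∀ Z ∈ S, ∀ x ∈ Z, ∀ y ∈ Z, dist x y ≤ ρ) {X : Finset Γ} (n : ℕ) (z : Γ)
    (hz : ∀ x ∈ X, (n : ℝ) * ρ < dist z x) : (propagate ℓ S ^ n) (indicatorFun X) z = 0 := by
  induction n generalizing z with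
  | zero =>
    rw [pow_zero, Module.End.one_apply, indicatorFun, if_neg]
    intro h
    simpa using hz z h
  | succ n ih =>
    rw [pow_succ', Module.End.mul_apply, propagate_apply]
    refine sum_eq_zero fun Z hZ => ?_
    rw [mem_filter] at hZ
    rw [sum_eq_zero, mul_zero]
    refine fun y hy => ih y fun x hx => ?_
    have h1 := hz x hx
    have h2 := hρ Z hZ.1 z hZ.2 y hy
    have h3 := dist_triangle z y x
    push_cast at h1
    linarith

end Kernel

end OpenSpin

namespace OpenSpin

/-! ### Mass of the propagation bound far from X, and the weight of long sets -/

section KernelTail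

open Finset

variable {Γ : Type*} [DecidableEq Γ] [MetricSpace Γ] {ℓ : Finset Γ → ℝ}
  {S : Finset (Finset Γ)} {Λ : Finset Γ} {F : ℝ → ℝ} {N : ℝ}

theorem sum_propagationBound_le (hS : ∀ Z ∈ S, Z ⊆ Λ) (hℓ : ∀ Z ∈ S, 0 ≤ ℓ Z) (hN0 : 0 ≤ N)
    (hN : ∀ x y : Γ, ∑ Z ∈ S with x ∈ Z ∧ y ∈ Z, ℓ Z ≤ N * F (dist x y))
    (hF : ∀ r, 0 ≤ r → 0 ≤ F r) {C : ℝ} (hC0 : 0 < C)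
    (hC : ∀ x y : Γ, ∑ z ∈ Λ, F (dist x z) * F (dist z y) ≤ C * F (dist x y))
    {G : ℝ} (hG0 : 0 ≤ G) (hG : ∀ x : Γ, ∑ y ∈ Λ, F (dist x y) ≤ G)
    {ρ : ℝ} (hρ0 : 0 ≤ ρ) (hρ : ∀ Z ∈ S, ∀ x ∈ Z, ∀ y ∈ Z, dist x y ≤ ρ)
    {X T : Finset Γ} (hX : X ⊆ Λ) {b : ℝ} (hb : 1 ≤ b)
    (hT : ∀ y ∈ T, ∀ x ∈ X, b * ρ < dist y x)
    {B : ℝ} (hB0 : 0 ≤ B) (hB : ∀ x ∈ X, ∑ y ∈ T, F (dist y x) ≤ B)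
    {t : ℝ} (ht : 0 ≤ t) (htb : Real.exp 1 * (N * C * t) ≤ b) (n : ℕ) :
    ∑ y ∈ T, propagationBound (propagate ℓ S) X n t y ≤
      X.card * B * (N * t * Real.exp 1) + T.card * ((t * (N * G)) ^ n / n.factorial) := by
  have hexp : ∑ y ∈ T, propagationBound (propagate ℓ S) X n t y =
      ∑ k ∈ range n, t ^ k / k.factorial * ∑ y ∈ T, (propagate ℓ S ^ k) (indicatorFun X) y +
        ∑ y ∈ T, t ^ n / n.factorial * (propagate ℓ S ^ n) 1 y := by
    simp only [propagationBound, Pi.add_apply, Finset.sum_apply, Pi.smul_apply, smul_eq_mul,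
      sum_add_distrib, mul_sum]
    rw [sum_comm]
  rw [hexp]
  refine add_le_add ?_ ?_
  · have hterm : ∀ k ∈ range n,
        t ^ k / k.factorial * ∑ y ∈ T, (propagate ℓ S ^ k) (indicatorFun X) y ≤
          if b < (k : ℝ) then X.card * B / C * ((N * C * t) ^ k / k.factorial) else 0 := by
      intro k _
      split_ifs with hbk
      · obtain ⟨j, rfl⟩ : ∃ j, k = j + 1 := Nat.exists_eq_succ_of_ne_zero fun h0 => by
          rw [h0] at hbk
          norm_num at hbk
          linarith
        have h1 : ∑ y ∈ T, (propagate ℓ S ^ (j + 1)) (indicatorFun X) y ≤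
            N ^ (j + 1) * C ^ j * (X.card * B) := by
          refine (sum_le_sum fun y _ => propagate_pow_indicator_le hS hℓ hN0 hN hF hC0.le hC hX
            j y).trans ?_
          rw [← mul_sum, sum_comm]
          gcongr
          rw [← nsmul_eq_mul]
          exact sum_le_card_nsmul _ _ _ hB
        calc _ ≤ t ^ (j + 1) / (j + 1).factorial * (N ^ (j + 1) * C ^ j * (X.card * B)) := by
              gcongr
          _ = _ := by
              field_simp
              ring
      · rw [sum_eq_zero, mul_zero]
        intro y hy
        refine propagate_pow_indicator_eq_zero hρ k y fun x hx => lt_of_le_of_lt ?_ (hT y hy x hx)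
        gcongr
        exact not_lt.1 hbk
    refine (sum_le_sum hterm).trans ?_
    rw [← sum_filter, ← mul_sum]
    calc _ ≤ X.card * B / C * (N * C * t * Real.exp 1) := by
          gcongr
          exact sum_pow_div_factorial_le hb (by positivity) htb n
      _ = _ := by field_simp
  · rw [← nsmul_eq_mul]
    refine sum_le_card_nsmul _ _ _ fun y _ => ?_
    rw [mul_pow, mul_div_right_comm]
    gcongr
    exact propagate_pow_one_le hS hℓ hN0 hN hF hG0 hG n y

/-- The sets of large diameter that meet `Y`, those contained in `Y` being counted twice. -/
theorem sum_long_le (hS : ∀ Z ∈ S, Z ⊆ Λ) (hℓ : ∀ Z ∈ S, 0 ≤ ℓ Z)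
    (hN : ∀ x y : Γ, ∑ Z ∈ S with x ∈ Z ∧ y ∈ Z, ℓ Z ≤ N * F (dist x y)) (hN0 : 0 ≤ N)
    {ρ : ℝ} (hρ0 : 0 ≤ ρ) {B : ℝ}
    (hB : ∀ x : Γ, ∑ y ∈ Λ with ρ / 2 ≤ dist y x, F (dist y x) ≤ B) (Y : Finset Γ) :
    ∑ Z ∈ S with (¬∀ x ∈ Z, ∀ y ∈ Z, dist x y ≤ ρ) ∧ ¬Disjoint Y Z, ℓ Z +
      ∑ Z ∈ S with (¬∀ x ∈ Z, ∀ y ∈ Z, dist x y ≤ ρ) ∧ Z ⊆ Y, ℓ Z ≤ Y.card * (N * B) := by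
  have h1 : ∑ Z ∈ S with (¬∀ x ∈ Z, ∀ y ∈ Z, dist x y ≤ ρ) ∧ ¬Disjoint Y Z, ℓ Z +
      ∑ Z ∈ S with (¬∀ x ∈ Z, ∀ y ∈ Z, dist x y ≤ ρ) ∧ Z ⊆ Y, ℓ Z ≤
      ∑ w ∈ Y, ∑ Z ∈ S with (¬∀ x ∈ Z, ∀ y ∈ Z, dist x y ≤ ρ) ∧ w ∈ Z, ℓ Z := by
    simp only [sum_filter]
    rw [sum_comm, ← sum_add_distrib]
    refine sum_le_sum fun Z hZ => ?_
    have hℓZ := hℓ Z hZ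
    by_cases hlong : ∀ x ∈ Z, ∀ y ∈ Z, dist x y ≤ ρ
    · simp only [iff_true_intro hlong, not_true, false_and, if_false, sum_const_zero, add_zero, le_refl]
    simp only [hlong, not_false_eq_true, true_and]
    rw [← sum_filter, sum_const, nsmul_eq_mul, filter_mem_eq_inter]
    by_cases hYZ : Z ⊆ Y
    · rw [if_pos hYZ, inter_eq_right.2 hYZ]
      -- A long set has two distinct points, so if it lies in Y the sum over w ∈ Y counts it at
      -- least twice, which pays for both sums on the left.
      have h2 : 1 < Z.card := by
        push Not at hlong
        obtain ⟨x, hx, y, hy, hxy⟩ := hlong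
        exact one_lt_card.2 ⟨x, hx, y, hy, dist_pos.1 (hρ0.trans_lt hxy)⟩
      have h3 : (2 : ℝ) ≤ Z.card := by exact_mod_cast h2
      have h4 : (if ¬Disjoint Y Z then ℓ Z else 0) ≤ ℓ Z := by
        split_ifs
        exacts [hℓZ, le_rfl]
      nlinarith
    · rw [if_neg hYZ, add_zero]
      split_ifs with hd
      · positivity
      · have h3 : (1 : ℝ) ≤ (Y ∩ Z).card := by
          obtain ⟨y, hy, hyZ⟩ := not_disjoint_iff.1 hd
          exact_mod_cast card_pos.2 ⟨y, mem_inter.2 ⟨hy, hyZ⟩⟩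
        exact le_mul_of_one_le_left hℓZ h3
  refine h1.trans ?_
  rw [← nsmul_eq_mul]
  refine sum_le_card_nsmul _ _ _ fun w _ => ?_
  -- Of two points more than ρ apart, one is at distance at least ρ/2 from w.
  calc _ ≤ ∑ Z ∈ S.filter (w ∈ ·) with ¬Disjoint (Λ.filter fun y => ρ / 2 ≤ dist y w) Z, ℓ Z := by
        refine sum_le_sum_of_subset_of_nonneg (fun Z hZ => ?_) fun Z hZ _ =>
          hℓ Z (mem_filter.1 (mem_filter.1 hZ).1).1
        obtain ⟨hZS, hlong, hw⟩ := mem_filter.1 hZ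
        refine mem_filter.2 ⟨mem_filter.2 ⟨hZS, hw⟩, ?_⟩
        push Not at hlong
        obtain ⟨x, hx, y, hy, hxy⟩ := hlong
        have h2 := dist_triangle_right x y w
        rw [not_disjoint_iff]
        rcases le_total (ρ / 2) (dist x w) with h3 | h3
        · exact ⟨x, mem_filter.2 ⟨hS Z hZS hx, h3⟩, hx⟩
        · exact ⟨y, mem_filter.2 ⟨hS Z hZS hy, by linarith⟩, hy⟩
    _ ≤ ∑ y ∈ Λ with ρ / 2 ≤ dist y w, ∑ Z ∈ S.filter (w ∈ ·) with y ∈ Z, ℓ Z :=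
        sum_filter_not_disjoint_le _ _ fun Z hZ => hℓ Z (mem_filter.1 hZ).1
    _ ≤ ∑ y ∈ Λ with ρ / 2 ≤ dist y w, N * F (dist y w) := by
        refine sum_le_sum fun y _ => ?_
        rw [filter_filter, dist_comm]
        exact hN w y
    _ ≤ N * B := by
        rw [← mul_sum]
        exact mul_le_mul_of_nonneg_left (hB w) hN0

end KernelTail

/-! ### Dissipative interactions as local families -/

section Interaction

open Finset

variable {Γ : Type*} [DecidableEq Γ] {ι : Γ → Type*}
  [∀ x, Fintype (ι x)] [∀ x, DecidableEq (ι x)]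

/-- The term `L_Z ⊗ id` on `𝒜_Λ`, for `Z ⊆ Λ`. -/
noncomputable def Interaction.localTerm (L : Interaction ι) (Λ Z : Finset Γ) : Obs ι Λ →L[ℂ] Obs ι Λ :=
  if h : Z ⊆ Λ then LinearMap.toContinuousLinearMap (extend h (L.term Z)) else 0

theorem Interaction.localTerm_apply (L : Interaction ι) {Λ Z : Finset Γ} (h : Z ⊆ Λ)
    (A : Obs ι Λ) : L.localTerm Λ Z A = extend h (L.term Z) A := by
  simp [localTerm, h]

theorem Interaction.generator_eq (L : Interaction ι) (Λ : Finset Γ) :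
    L.generator Λ = ∑ Z ∈ Λ.powerset, L.localTerm Λ Z := by
  ext1 A
  rw [generator, ← sum_attach Λ.powerset]
  simp only [LinearMap.coe_toContinuousLinearMap', LinearMap.sum_apply, _root_.sum_apply]
  exact sum_congr rfl fun Z _ => (L.localTerm_apply _ A).symm

theorem Interaction.cbNorm_ne_top [MetricSpace Γ] (L : Interaction ι) {F : ℝ → ℝ}
    (hL : L.fNorm F ≠ ∞) {Z : Finset Γ} (hZ : Z.Nonempty) : cbNorm (L.term Z) ≠ ∞ := by
  obtain ⟨x, hx⟩ := hZ
  obtain ⟨M, hM, hM'⟩ := sInf_lt_iff.1 (lt_top_iff_ne_top.2 hL)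
  refine ne_top_of_le_ne_top (ENNReal.mul_ne_top hM'.ne ENNReal.ofReal_ne_top)
    (le_trans ?_ (hM x x))
  exact ENNReal.le_tsum (f := fun Z : {Z : Finset Γ // x ∈ Z ∧ x ∈ Z} => cbNorm (L.term Z.1))
    ⟨Z, hx, hx⟩

theorem Interaction.sum_cbNorm_le [MetricSpace Γ] (L : Interaction ι) {F : ℝ → ℝ}
    (hF : ∀ r, 0 ≤ r → 0 < F r) (hL : L.fNorm F ≠ ∞) (S : Finset (Finset Γ)) (x y : Γ) :
    ∑ Z ∈ S with x ∈ Z ∧ y ∈ Z, (cbNorm (L.term Z)).toReal ≤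
      (L.fNorm F).toReal * F (dist x y) := by
  have hp := hF (dist x y) dist_nonneg
  have h1 : ∑' Z : {Z : Finset Γ // x ∈ Z ∧ y ∈ Z}, cbNorm (L.term Z.1) ≤
      L.fNorm F * ENNReal.ofReal (F (dist x y)) :=
    le_sInf_mul_of_forall (ENNReal.ofReal_pos.2 hp).ne' ENNReal.ofReal_ne_top
      fun C hC => hC x y
  have h2 := (ENNReal.sum_le_tsum (S.subtype fun Z => x ∈ Z ∧ y ∈ Z)).trans h1
  rw [sum_subtype_eq_sum_filter (fun Z => cbNorm (L.term Z))] at h2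
  rw [← ENNReal.toReal_sum fun Z hZ => L.cbNorm_ne_top hL ⟨x, (mem_filter.1 hZ).2.1⟩]
  refine (ENNReal.toReal_mono (ENNReal.mul_ne_top hL ENNReal.ofReal_ne_top) h2).trans ?_
  rw [ENNReal.toReal_mul, ENNReal.toReal_ofReal hp.le]

theorem Interaction.isLocalFamily [MetricSpace Γ] (L : Interaction ι) {F : ℝ → ℝ}
    (hL : L.fNorm F ≠ ∞) (Λ : Finset Γ) :
    IsLocalFamily Λ.powerset (L.localTerm Λ) fun Z => (cbNorm (L.term Z)).toReal where
  nonneg _ _ := ENNReal.toReal_nonneg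
  empty := by
    ext1 A
    rw [L.localTerm_apply (empty_subset Λ), ← embed_refl A,
      extend_embed_of_disjoint _ subset_rfl (disjoint_empty_left Λ) (L.lindblad ∅)]
    rfl
  norm_le Z hZ A := by
    -- The F-norm does not see Z = ∅, but a Lindblad generator on scalars is zero.
    rcases Z.eq_empty_or_nonempty with rfl | hne
    · rw [L.localTerm_apply (empty_subset Λ), ← embed_refl A,
        extend_embed_of_disjoint _ subset_rfl (disjoint_empty_left Λ) (L.lindblad ∅), norm_zero]
      positivity
    · rw [L.localTerm_apply (mem_powerset.1 hZ)]
      exact norm_extend_le _ _ (L.cbNorm_ne_top hL hne) A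
  commute Z hZ Z' hZ' hd := by
    ext1 A
    rw [mul_apply_eq_comp, mul_apply_eq_comp, L.localTerm_apply (mem_powerset.1 hZ),
      L.localTerm_apply (mem_powerset.1 hZ'), L.localTerm_apply (mem_powerset.1 hZ),
      L.localTerm_apply (mem_powerset.1 hZ')]
    exact extend_comm_of_disjoint _ _ hd (L.lindblad Z) (L.lindblad Z') A
  contraction S hS t ht A := by
    have h1 : IsAccretiveNeg (∑ Z ∈ S, (L.localTerm Λ Z : Obs ι Λ →ₗ[ℂ] Obs ι Λ)) := by
      refine isAccretiveNeg_sum S fun Z hZ => ?_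
      have hZ' := mem_powerset.1 (hS hZ)
      have h2 : (L.localTerm Λ Z : Obs ι Λ →ₗ[ℂ] Obs ι Λ) = extend hZ' (L.term Z) :=
        LinearMap.ext fun A => L.localTerm_apply hZ' A
      rw [h2]
      exact ((L.lindblad Z).extend hZ').isAccretiveNeg
    have h3 : LinearMap.toContinuousLinearMap
        (∑ Z ∈ S, (L.localTerm Λ Z : Obs ι Λ →ₗ[ℂ] Obs ι Λ)) = ∑ Z ∈ S, L.localTerm Λ Z := by
      ext1 A
      simp [_root_.sum_apply]
    rw [← h3]
    exact h1.isDissipative.norm_exp_apply_le ht A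

theorem exp_apply_of_intertwine {E E' : Type*} [NormedAddCommGroup E] [NormedSpace ℂ E]
    [CompleteSpace E] [NormedAddCommGroup E'] [NormedSpace ℂ E'] [CompleteSpace E']
    (J : E →L[ℂ] E') (P : E →L[ℂ] E) (R : E' →L[ℂ] E') (h : ∀ A, J (P A) = R (J A)) (A : E) :
    J (NormedSpace.exp P A) = NormedSpace.exp R (J A) := by
  have hpow : ∀ n : ℕ, J ((P ^ n) A) = (R ^ n) (J A) := fun n => by
    induction n with
    | zero => simp
    | succ n ih => rw [pow_succ', pow_succ', mul_apply_eq_comp, mul_apply_eq_comp, h, ih]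
  have h1 := ((NormedSpace.exp_series_hasSum_exp' (𝕂 := ℂ) P).mapL
    (ContinuousLinearMap.apply ℂ E A)).mapL J
  have h2 := (NormedSpace.exp_series_hasSum_exp' (𝕂 := ℂ) R).mapL
    (ContinuousLinearMap.apply ℂ E' (J A))
  simp only [ContinuousLinearMap.apply_apply, map_smul, hpow] at h1 h2
  exact h1.unique h2

/-- Places the dynamics of Y inside 𝒜_Λ, so that all comparisons happen in one algebra. -/
theorem Interaction.embed_dynamics (L : Interaction ι) {Y Λ : Finset Γ} (hY : Y ⊆ Λ) (t : ℝ)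
    (B : Obs ι Y) : embed hY (L.dynamics Y t B) =
      NormedSpace.exp ((t : ℂ) • ∑ Z ∈ Λ.powerset with Z ⊆ Y, L.localTerm Λ Z) (embed hY B) := by
  refine exp_apply_of_intertwine
    (LinearMap.toContinuousLinearMap (embedHom (ι := ι) hY : Obs ι Y →ₗ[ℂ] Obs ι Λ))
    ((t : ℂ) • L.generator Y) _ (fun A => ?_) B
  have hfilter : Λ.powerset.filter (· ⊆ Y) = Y.powerset := by
    ext Z
    simp only [mem_filter, mem_powerset]
    exact ⟨fun h => h.2, fun h => ⟨h.trans hY, h⟩⟩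
  rw [hfilter, L.generator_eq]
  simp only [_root_.smul_apply, _root_.sum_apply, map_smul, map_sum]
  congr 1
  refine sum_congr rfl fun Z hZ => ?_
  have hZY := mem_powerset.1 hZ
  rw [L.localTerm_apply hZY, L.localTerm_apply (hZY.trans hY)]
  exact embed_extend hZY hY (L.lindblad Z) A

end Interaction

end OpenSpin

namespace OpenSpin

/-! ### Assembly of the localization estimate -/

section Localization

open Finset Filter Topology

variable {Γ : Type*} [MetricSpace Γ] [DecidableEq Γ] {ι : Γ → Type*}
  [∀ x, Fintype (ι x)] [∀ x, DecidableEq (ι x)]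

/-- The localization estimate for a range cut-off `ρ`, with the decay function entering through
its tail sums. -/
theorem Interaction.norm_dynamics_sub_le [Nonempty Γ] (L : Interaction ι) {F : ℝ → ℝ}
    (hF : IsFFunction Γ F) (hL : L.fNorm F ≠ ∞) (hC : 0 < (convConst Γ F).toReal)
    {G B₁ B₂ ρ r b : ℝ} (hρ : 0 ≤ ρ) (hr : 0 ≤ r) (hb : 1 ≤ b) (hbρ : b * ρ ≤ r)
    (hG : ∀ (x : Γ) (T : Finset Γ), ∑ y ∈ T, F (dist y x) ≤ G)
    (hB₁ : ∀ (x : Γ) (T : Finset Γ), (∀ y ∈ T, ρ / 2 ≤ dist y x) → ∑ y ∈ T, F (dist y x) ≤ B₁)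
    (hB₂ : ∀ (x : Γ) (T : Finset Γ), (∀ y ∈ T, r ≤ dist y x) → ∑ y ∈ T, F (dist y x) ≤ B₂)
    {X Λ : Finset Γ} (hX : X ⊆ Λ) (A : Obs ι X) {t : ℝ} (ht : 0 ≤ t)
    (htb : Real.exp 1 * ((L.fNorm F).toReal * (convConst Γ F).toReal * t) ≤ b) :
    ‖L.dynamics Λ t (embed hX A) - embed (inflationIn_subset Λ X r)
        (L.dynamics (inflationIn Λ X r) t (embed (subset_inflationIn hX hr) A))‖ ≤
      ‖A‖ * (L.fNorm F).toReal * t *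
        ((inflationIn Λ X r).card * B₁ + X.card * B₂ * Real.exp 1) := by
  obtain ⟨x₀⟩ := ‹Nonempty Γ›
  set N := (L.fNorm F).toReal with hNdef
  set C := (convConst Γ F).toReal with hCdef
  set Y := inflationIn Λ X r with hY
  set ℓ : Finset Γ → ℝ := fun Z => (cbNorm (L.term Z)).toReal with hℓ
  set U := Λ.powerset with hU
  set S := U.filter (fun Z => ∀ x ∈ Z, ∀ y ∈ Z, dist x y ≤ ρ) with hSdef
  have hN0 : 0 ≤ N := ENNReal.toReal_nonneg
  have hG0 : 0 ≤ G := by simpa using hG x₀ ∅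
  have hB₂0 : 0 ≤ B₂ := by simpa using hB₂ x₀ ∅
  have hℓ0 : ∀ Z, 0 ≤ ℓ Z := fun Z => ENNReal.toReal_nonneg
  have hD := L.isLocalFamily hL Λ
  have hSU : S ⊆ U := filter_subset _ _
  have hUΛ : ∀ Z ∈ U, Z ⊆ Λ := fun Z hZ => mem_powerset.1 hZ
  have hXY : X ⊆ Y := subset_inflationIn hX hr
  have hYΛ : Y ⊆ Λ := inflationIn_subset Λ X r
  have hN : ∀ (S' : Finset (Finset Γ)) (x y : Γ),
      ∑ Z ∈ S' with x ∈ Z ∧ y ∈ Z, ℓ Z ≤ N * F (dist x y) := L.sum_cbNorm_le hF.pos hL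
  set a := embed hX A with ha
  have haX : ∀ Z ∈ U, Disjoint Z X → L.localTerm Λ Z a = 0 := fun Z hZ hd => by
    rw [L.localTerm_apply (hUΛ Z hZ)]
    exact extend_embed_of_disjoint _ _ hd (L.lindblad Z) A
  have hnotS : ∀ Z ∈ U, (Z ∉ S ↔ ¬∀ x ∈ Z, ∀ y ∈ Z, dist x y ≤ ρ) := fun Z hZ => by
    simp [hSdef, hZ]
  have hfull : L.dynamics Λ t a =
      NormedSpace.exp ((t : ℂ) • ∑ Z ∈ U, L.localTerm Λ Z) a := by
    rw [dynamics, L.generator_eq]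
  have hloc : embed hYΛ (L.dynamics Y t (embed hXY A)) =
      NormedSpace.exp ((t : ℂ) • ∑ Z ∈ U with Z ⊆ Y, L.localTerm Λ Z) a := by
    rw [L.embed_dynamics hYΛ, embed_embed]
  rw [hfull, hloc]
  have htrunc := hD.norm_sub_le_of_truncation hSU Y a ht
  have hlong : ∑ Z ∈ U with Z ∉ S ∧ ¬Disjoint Y Z, ℓ Z + ∑ Z ∈ U with Z ∉ S ∧ Z ⊆ Y, ℓ Z ≤
      Y.card * (N * B₁) := by
    have h := sum_long_le hUΛ (fun Z _ => hℓ0 Z) (hN U) hN0 hρ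
      (fun x => hB₁ x _ fun y hy => (mem_filter.1 hy).2) Y
    have e₁ := filter_congr (s := U) (p := fun Z => Z ∉ S ∧ ¬Disjoint Y Z) fun Z hZ =>
      and_congr_left' (hnotS Z hZ)
    have e₂ := filter_congr (s := U) (p := fun Z => Z ∉ S ∧ Z ⊆ Y) fun Z hZ =>
      and_congr_left' (hnotS Z hZ)
    rw [e₁, e₂]
    exact h
  have hbound : ∀ n : ℕ,
      ‖NormedSpace.exp ((t : ℂ) • ∑ Z ∈ U, L.localTerm Λ Z) a -
        NormedSpace.exp ((t : ℂ) • ∑ Z ∈ U with Z ⊆ Y, L.localTerm Λ Z) a‖ ≤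
      ‖a‖ * (t * (Y.card * (N * B₁)) + (X.card * B₂ * (N * t * Real.exp 1) +
        (Λ \ Y).card * ((t * (N * G)) ^ (n + 1) / (n + 1).factorial))) := by
    intro n
    have h1 := hD.norm_sub_le_of_subset hSU hUΛ hXY haX n ht
    have h2 : ∑ y ∈ Λ \ Y, propagationBound (propagate ℓ S) X (n + 1) t y ≤ _ :=
      sum_propagationBound_le (fun Z hZ => hUΛ Z (hSU hZ)) (fun Z _ => hℓ0 Z) hN0 (hN S)
        (fun r hr => (hF.pos r hr).le) hC (fun x y => hF.sum_conv_le x y Λ) hG0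
        (fun x => by simpa only [dist_comm x] using hG x Λ) hρ
        (fun Z hZ => (mem_filter.1 hZ).2) hX hb (T := Λ \ Y)
        (fun y hy x hx => by
          refine hbρ.trans_lt (not_le.1 fun hle => (mem_sdiff.1 hy).2 ?_)
          exact mem_inflationIn.2 ⟨(mem_sdiff.1 hy).1, x, hx, hle⟩) hB₂0
        (fun x hx => hB₂ x _ fun y hy => by
          refine (not_le.1 fun hle => (mem_sdiff.1 hy).2 ?_).le
          exact mem_inflationIn.2 ⟨(mem_sdiff.1 hy).1, x, hx, hle⟩) ht htb (n + 1)
    refine (norm_sub_le_norm_sub_add_norm_sub _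
      (NormedSpace.exp ((t : ℂ) • ∑ Z ∈ S with Z ⊆ Y, L.localTerm Λ Z) a) _).trans ?_
    rw [norm_sub_rev (NormedSpace.exp ((t : ℂ) • ∑ Z ∈ S with Z ⊆ Y, L.localTerm Λ Z) a)]
    refine (add_le_add h1 htrunc).trans ?_
    rw [← mul_add]
    refine mul_le_mul_of_nonneg_left ?_ (norm_nonneg a)
    have h3 := mul_le_mul_of_nonneg_left hlong ht
    rw [mul_add] at h3
    linarith
  -- The truncation order is free, and the remainder vanishes as n → ∞ for fixed Λ.
  have hlim : Tendsto (fun n : ℕ => ‖a‖ * (t * (Y.card * (N * B₁)) +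
      (X.card * B₂ * (N * t * Real.exp 1) +
        (Λ \ Y).card * ((t * (N * G)) ^ (n + 1) / (n + 1).factorial)))) atTop
      (𝓝 (‖a‖ * (t * (Y.card * (N * B₁)) + (X.card * B₂ * (N * t * Real.exp 1) +
        (Λ \ Y).card * 0)))) :=
    ((((((FloorSemiring.tendsto_pow_div_factorial_atTop (t * (N * G))).comp
      (tendsto_add_atTop_nat 1)).const_mul _).const_add _).const_add _).const_mul _)
  refine (ge_of_tendsto' hlim hbound).trans ?_
  have hB₁0 : 0 ≤ B₁ := by simpa using hB₁ x₀ ∅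
  have haA : ‖a‖ ≤ ‖A‖ := norm_embed_le hX A
  calc _ = ‖a‖ * (N * t * (Y.card * B₁ + X.card * B₂ * Real.exp 1)) := by ring
    _ ≤ ‖A‖ * (N * t * (Y.card * B₁ + X.card * B₂ * Real.exp 1)) := by gcongr
    _ = _ := by ring

end Localization

/-! ### Comparison with the stated exponent and constant -/

section Constants

/-- Subadditivity of x ↦ x^(1-δ) gives (1+r)^(1-δ) ≤ 1 + r^(1-δ) ≤ 2(1 + r^(1-δ)/2). -/
theorem powerLaw_half_rpow_le {β δ r : ℝ} (hβ : 0 ≤ β) (hδ : 0 ≤ δ) (hδ' : δ ≤ 1) (hr : 0 ≤ r) :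
    powerLaw β (r ^ (1 - δ) / 2) ≤ 2 ^ β / (1 + r) ^ ((1 - δ) * β) := by
  have h1 : (1 + r) ^ (1 - δ) ≤ 2 * (1 + r ^ (1 - δ) / 2) := by
    have h := Real.rpow_add_le_add_rpow zero_le_one hr (by linarith : 0 ≤ 1 - δ)
      (by linarith)
    rw [Real.one_rpow] at h
    linarith
  rw [powerLaw, div_le_div_iff₀ (by positivity) (by positivity), one_mul,
    ← Real.mul_rpow (by positivity) (by positivity), Real.rpow_mul (by positivity)]
  gcongr

/-- The argument yields the smaller constant κ C_ε (κ 2^β + e). The prefactor 1/C_F is absorbed by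
the C_F inside each bracket, and the other summands are dropped. -/
theorem localizationConst_ge {Γ : Type*} [MetricSpace Γ] {κ ν β ε δ : ℝ} (hκ : 0 < κ)
    (hβ : 0 ≤ β) (hε : 0 < ε) (hδ' : δ ≤ 1)
    (hC : 0 < (convConst Γ (powerLaw (β + (ν + (1 + ε))))).toReal) :
    κ * zetaConst ε * (κ * 2 ^ β + Real.exp 1) ≤
      localizationConst Γ κ ν (β + (ν + (1 + ε))) ε δ := by
  have hβ' : β + (ν + (1 + ε)) - ν - 1 - ε = β := by ring
  have hz := zetaConst_pos hε
  unfold localizationConst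
  rw [hβ']
  set C := (convConst Γ (powerLaw (β + (ν + (1 + ε))))).toReal
  have hFs : 0 ≤ (fSum Γ (powerLaw (β + (ν + (1 + ε))))).toReal := ENNReal.toReal_nonneg
  have h1 : κ * 2 ^ β * C ≤ κ * 2 ^ (2 * β) * 2 ^ (1 - δ) * (zetaConst ε + C) := by
    have h2 : (1 : ℝ) ≤ 2 ^ (1 - δ) := Real.one_le_rpow one_le_two (by linarith)
    calc κ * 2 ^ β * C ≤ κ * 2 ^ (2 * β) * C := by
          gcongr
          · norm_num
          · linarith
      _ ≤ κ * 2 ^ (2 * β) * 2 ^ (1 - δ) * C := by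
          exact mul_le_mul_of_nonneg_right (le_mul_of_one_le_right (by positivity) h2) hC.le
      _ ≤ _ := by
          gcongr
          linarith
  have h3 : Real.exp 1 * C ≤
      Real.exp 1 * (C + (fSum Γ (powerLaw (β + (ν + (1 + ε))))).toReal) := by
    gcongr
    linarith
  calc κ * zetaConst ε * (κ * 2 ^ β + Real.exp 1)
      = κ * zetaConst ε / C * (κ * 2 ^ β * C + Real.exp 1 * C) := by field_simp
    _ ≤ _ := by
        gcongr

end Constants

end OpenSpin

theorem theorem2p9 {Γ : Type*} [MetricSpace Γ] [Countable Γ] [Nonempty Γ] [DecidableEq Γ]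
    (ι : Γ → Type*) [∀ x, Fintype (ι x)] [∀ x, DecidableEq (ι x)]
    (κ ν : ℝ) (hκ : 0 < κ) (hν : 0 < ν) (hreg : OpenSpin.IsRegular Γ κ ν)
    (α : ℝ) (hα : 2 * ν + 1 < α)
    (L : OpenSpin.Interaction ι) (hL : L.fNorm (OpenSpin.powerLaw α) ≠ ⊤)
    (ε : ℝ) (hε : 0 < ε) (hε' : ε < α - 2 * ν - 1)
    (δ : ℝ) (hδ : 0 < δ) (hδ' : δ < 1) (hδν : ν < (1 - δ) * (α - ν - 1 - ε)) :
    OpenSpin.IsFFunction Γ (OpenSpin.powerLaw α) ∧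
    0 < OpenSpin.localizationConst Γ κ ν α ε δ ∧
    ∀ (X Λ : Finset Γ) (hX : X ⊆ Λ) (A : OpenSpin.Obs ι X) (r t : ℝ) (hr : 1 ≤ r),
      0 ≤ t →
      Real.exp 1 * ((L.fNorm (OpenSpin.powerLaw α)).toReal *
        (OpenSpin.convConst Γ (OpenSpin.powerLaw α)).toReal) * t ≤ r ^ δ →
      ‖L.dynamics Λ t (OpenSpin.embed hX A) -
          OpenSpin.embed (OpenSpin.inflationIn_subset Λ X r)
            (L.dynamics (OpenSpin.inflationIn Λ X r) t
              (OpenSpin.embed (OpenSpin.subset_inflationIn hX (zero_le_one.trans hr)) A))‖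
        ≤ OpenSpin.localizationConst Γ κ ν α ε δ * ‖A‖ * (X.card : ℝ) *
            (L.fNorm (OpenSpin.powerLaw α)).toReal *
            (t / (1 + r) ^ ((1 - δ) * (α - ν - 1 - ε) - ν)) := by
  open OpenSpin in
  -- β is α_ε, the decay left after ν + 1 + ε is spent on summability.
  obtain ⟨β, rfl⟩ : ∃ β, α = β + (ν + (1 + ε)) := ⟨α - (ν + (1 + ε)), by ring⟩
  have hβ' : β + (ν + (1 + ε)) - ν - 1 - ε = β := by ring
  rw [hβ'] at hδν
  have hβ : 0 ≤ β := by linarith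
  have hFs := hreg.fSum_ne_top hκ hν hε hβ
  have hF : IsFFunction Γ (powerLaw (β + (ν + (1 + ε)))) :=
    isFFunction_powerLaw (by positivity) hFs
  have hC : 0 < (convConst Γ (powerLaw (β + (ν + (1 + ε))))).toReal :=
    zero_lt_one.trans_le (one_le_convConst_toReal hF)
  have hz := zetaConst_pos hε
  have hconst := localizationConst_ge (Γ := Γ) (ν := ν) hκ hβ hε hδ'.le hC
  refine ⟨hF, lt_of_lt_of_le (by positivity) hconst, fun X Λ hX A r t hr ht htr => ?_⟩
  have hr0 : 0 < r := by linarith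
  have htail : ∀ s, 0 ≤ s → ∀ (x : Γ) (T : Finset Γ), (∀ y ∈ T, s ≤ dist y x) →
      ∑ y ∈ T, powerLaw (β + (ν + (1 + ε))) (dist y x) ≤ κ * zetaConst ε * powerLaw β s :=
    fun s hs x T hT => hreg.sum_powerLaw_tail_le hκ hν hε hβ hs x T hT
  -- The range r^(1-δ) and the order threshold r^δ multiply to r.
  have key := L.norm_dynamics_sub_le hF hL hC (ρ := r ^ (1 - δ)) (r := r) (b := r ^ δ)
    (by positivity) hr0.le (Real.one_le_rpow hr hδ.le)
    (by rw [← Real.rpow_add hr0, add_sub_cancel, Real.rpow_one])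
    (fun x T => htail 0 le_rfl x T fun y _ => dist_nonneg) (htail _ (by positivity))
    (htail r hr0.le) hX A ht (by rw [← mul_assoc]; exact htr)
  refine key.trans ?_
  rw [hβ']
  set N := (L.fNorm (powerLaw (β + (ν + (1 + ε))))).toReal
  set p := (1 - δ) * β - ν with hp
  have hr1 : 0 < 1 + r := by linarith
  have hlong : ((inflationIn Λ X r).card : ℝ) *
      (κ * zetaConst ε * powerLaw β (r ^ (1 - δ) / 2)) ≤
      X.card * (κ * zetaConst ε * (κ * 2 ^ β)) / (1 + r) ^ p := by
    calc _ ≤ X.card * (κ * (1 + r) ^ ν) *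
          (κ * zetaConst ε * (2 ^ β / (1 + r) ^ ((1 - δ) * β))) := by
          have := powerLaw_pos β (r := r ^ (1 - δ) / 2) (by positivity)
          gcongr
          · exact hreg.card_inflationIn_le hκ hν hr Λ X
          · exact powerLaw_half_rpow_le hβ hδ.le hδ'.le hr0.le
      _ = _ := by
          rw [hp, Real.rpow_sub hr1]
          field_simp
  have hshort : (X.card : ℝ) * (κ * zetaConst ε * powerLaw β r) * Real.exp 1 ≤
      X.card * (κ * zetaConst ε * Real.exp 1) / (1 + r) ^ p := by
    have h1 : powerLaw β r ≤ 1 / (1 + r) ^ p := by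
      unfold powerLaw
      gcongr
      · linarith
      · nlinarith
    calc _ ≤ (X.card : ℝ) * (κ * zetaConst ε * (1 / (1 + r) ^ p)) * Real.exp 1 := by gcongr
      _ = _ := by ring
  calc _ ≤ ‖A‖ * N * t * (X.card * (κ * zetaConst ε * (κ * 2 ^ β)) / (1 + r) ^ p +
        X.card * (κ * zetaConst ε * Real.exp 1) / (1 + r) ^ p) := by
        gcongr
    _ = κ * zetaConst ε * (κ * 2 ^ β + Real.exp 1) * ‖A‖ * X.card * N * (t / (1 + r) ^ p) := by
        ring
    _ ≤ _ := by
        gcongr
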